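/- Let $C([0,\infty])$ be the Banach space of complex-valued continuous functions on $[0,\infty[$ that have a finite limit at $\infty$, with the sup-norm $\|\cdot\|_\infty$. For $\gamma>0$ and $b\ge 0$ let $A^{\gamma,b}$ be the operator $A^{\gamma,b}u(x)=\gamma x u''(x)+b u'(x)$ in $C([0,\infty])$ (its value at $0$ being the limit of this expression as $x\to 0^+$) with domain $$D(A^{\gamma,0})=\{u\in C([0,\infty])\cap C^2(]0,\infty[) : \lim_{x\to0^+}A^{\gamma,0}u(x)=0,\ \lim_{x\to+\infty}A^{\gamma,0}u(x)=0\}\quad\text{if } b=0,$$ $$D(A^{\gamma,b})=\{u\in C^1([0,\infty[)\cap C^2(]0,\infty[)\cap C([0,\infty]) : \lim_{x\to0^+}xu''(x)=0,\ \lim_{x\to+\infty}A^{\gamma,b}u(x)=0\}\quad\text{if } b>0.$$ Let $B,\gamma_0>0$. Then there exists $\theta_1=\theta_1(B,\gamma_0)\in\,]0,\frac{\pi}{2}]$ such that for every $\theta\in\,]0,\theta_1[$ there exists $d_1=d_1(B,\gamma_0,\theta)>0$ with the following property: for every $b\in[0,B]$, every $\gamma\ge\gamma_0$ and every $\lambda\in\mathbb{C}\setminus\{0\}$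 with $|\arg\lambda|\le\frac{\pi}{2}+\theta$ (where $\arg\lambda\in\,]-\pi,\pi]$), $\lambda$ belongs to the resolvent set of $A^{\gamma,b}$, and the resolvent $R(\lambda,A^{\gamma,b})=(\lambda-A^{\gamma,b})^{-1}$ satisfies $$\|R(\lambda,A^{\gamma,b})f\|_\infty\le d_1\,\frac{\|f\|_\infty}{|\lambda|}\qquad\text{for every } f\in C([0,\infty]).$$ -/

import Mathlib

open Filter Topology Set
open scoped NNReal BoundedContinuousFunction

noncomputable section

namespace DegenerateDiffusion

/-- The space `C([0,∞])` of complex-valued continuous functions on `[0,∞[` that have a (finite)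
limit at infinity. Such functions are bounded; the norm is the sup-norm, inherited from the space
of bounded continuous functions. -/
def convergentFunctions : Submodule ℂ (ℝ≥0 →ᵇ ℂ) where
  carrier := {u | ∃ l : ℂ, Tendsto (fun x : ℝ≥0 => u x) atTop (𝓝 l)}
  zero_mem' := ⟨0, by simp⟩
  add_mem' := by
    rintro u v ⟨l, hl⟩ ⟨m, hm⟩
    exact ⟨l + m, by simpa using hl.add hm⟩
  smul_mem' := by
    rintro c u ⟨l, hl⟩
    exact ⟨c • l, by simpa using hl.const_smul c⟩

/-- The Banach space `C([0,∞])`. -/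
abbrev CInfty : Type := convergentFunctions

/-- `u : [0,∞[ → ℂ` as a function of a real variable. Only its values and derivatives on `[0,∞[`
are used below. -/
def ext (u : CInfty) : ℝ → ℂ := fun x => (u : ℝ≥0 →ᵇ ℂ) x.toNNReal

/-- The first derivative on `[0,∞[` (one-sided at `0`). -/
def d1 (u : CInfty) : ℝ → ℂ := derivWithin (ext u) (Ici 0)

/-- The second derivative on `]0,∞[` (its value at `0` is never used). -/
def d2 (u : CInfty) : ℝ → ℂ := deriv (deriv (ext u))

/-- The differential expression `γ x u''(x) + b u'(x)`. At `x = 0` this is `b u'(0)`. -/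
def expr (γ b : ℝ) (u : CInfty) (x : ℝ) : ℂ :=
  (γ : ℂ) * (x : ℂ) * d2 u x + (b : ℂ) * d1 u x

/-- Membership in the domain `D(A^{γ,b})`. -/
structure InDomain (γ b : ℝ) (u : CInfty) : Prop where
  /-- `u ∈ C²(]0,∞[)` -/
  contDiffOn_two : ContDiffOn ℝ 2 (ext u) (Ioi 0)
  /-- `γ x u''(x) + b u'(x) → 0` as `x → ∞` -/
  tendsto_atTop : Tendsto (expr γ b u) atTop (𝓝 0)
  /-- if `b = 0`: `γ x u''(x) → 0` as `x → 0⁺` -/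
  tendsto_zero_of_eq : b = 0 → Tendsto (expr γ b u) (𝓝[>] 0) (𝓝 0)
  /-- if `b ≠ 0`: `u ∈ C¹([0,∞[)` -/
  contDiffOn_one : b ≠ 0 → ContDiffOn ℝ 1 (ext u) (Ici 0)
  /-- if `b ≠ 0`: `x u''(x) → 0` as `x → 0⁺` -/
  tendsto_zero_of_ne : b ≠ 0 → Tendsto (fun x : ℝ => (x : ℂ) * d2 u x) (𝓝[>] 0) (𝓝 0)

theorem d1_eq_deriv (u : CInfty) {x : ℝ} (hx : 0 < x) : d1 u x = deriv (ext u) x :=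
  derivWithin_of_mem_nhds (Ici_mem_nhds hx)

theorem contDiffOn_deriv {u : CInfty} (h : ContDiffOn ℝ 2 (ext u) (Ioi 0)) :
    ContDiffOn ℝ 1 (deriv (ext u)) (Ioi 0) := by
  have h' : ContDiffOn ℝ (1 + 1) (ext u) (Ioi 0) := by
    simpa [one_add_one_eq_two] using h
  exact ((contDiffOn_succ_iff_deriv_of_isOpen isOpen_Ioi).1 h').2.2

theorem differentiableAt_ext {u : CInfty} (h : ContDiffOn ℝ 2 (ext u) (Ioi 0)) {x : ℝ}
    (hx : 0 < x) : DifferentiableAt ℝ (ext u) x :=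
  (h.differentiableOn (by norm_num)).differentiableAt (Ioi_mem_nhds hx)

theorem differentiableAt_deriv {u : CInfty} (h : ContDiffOn ℝ 2 (ext u) (Ioi 0)) {x : ℝ}
    (hx : 0 < x) : DifferentiableAt ℝ (deriv (ext u)) x :=
  ((contDiffOn_deriv h).differentiableOn (by norm_num)).differentiableAt (Ioi_mem_nhds hx)

theorem ext_add (u v : CInfty) : ext (u + v) = ext u + ext v := rfl

theorem ext_smul (c : ℂ) (u : CInfty) : ext (c • u) = c • ext u := rfl

theorem d2_add {u v : CInfty} (hu : ContDiffOn ℝ 2 (ext u) (Ioi 0))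
    (hv : ContDiffOn ℝ 2 (ext v) (Ioi 0)) {x : ℝ} (hx : 0 < x) :
    d2 (u + v) x = d2 u x + d2 v x := by
  have h : deriv (ext (u + v)) =ᶠ[𝓝 x] deriv (ext u) + deriv (ext v) := by
    filter_upwards [Ioi_mem_nhds hx] with y hy
    rw [ext_add, deriv_add (differentiableAt_ext hu hy) (differentiableAt_ext hv hy)]
    rfl
  unfold d2
  rw [h.deriv_eq, deriv_add (differentiableAt_deriv hu hx) (differentiableAt_deriv hv hx)]

theorem d2_smul (c : ℂ) {u : CInfty} (hu : ContDiffOn ℝ 2 (ext u) (Ioi 0)) {x : ℝ}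
    (hx : 0 < x) : d2 (c • u) x = c * d2 u x := by
  have h : deriv (ext (c • u)) =ᶠ[𝓝 x] c • deriv (ext u) := by
    filter_upwards [Ioi_mem_nhds hx] with y hy
    rw [ext_smul, deriv_const_smul c (differentiableAt_ext hu hy)]
    rfl
  unfold d2
  rw [h.deriv_eq, deriv_const_smul c (differentiableAt_deriv hu hx), smul_eq_mul]

/-- For `u ∈ D(A^{γ,b})`, either `b = 0`, or `u` is differentiable at every point of `[0,∞[`. -/
theorem InDomain.mul_d1_add {γ b : ℝ} {u v : CInfty} (hu : InDomain γ b u)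
    (hv : InDomain γ b v) {x : ℝ} (hx : 0 ≤ x) :
    (b : ℂ) * d1 (u + v) x = b * d1 u x + b * d1 v x := by
  by_cases hb : b = 0
  · simp [hb]
  · unfold d1
    rw [ext_add, derivWithin_add ((hu.contDiffOn_one hb).differentiableOn (by norm_num) x hx)
      ((hv.contDiffOn_one hb).differentiableOn (by norm_num) x hx), mul_add]

theorem InDomain.mul_d1_smul {γ b : ℝ} (c : ℂ) {u : CInfty} (hu : InDomain γ b u) {x : ℝ}
    (hx : 0 ≤ x) : (b : ℂ) * d1 (c • u) x = c * (b * d1 u x) := by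
  by_cases hb : b = 0
  · simp [hb]
  · unfold d1
    rw [ext_smul, derivWithin_const_smul c
      ((hu.contDiffOn_one hb).differentiableOn (by norm_num) x hx), smul_eq_mul]
    ring

theorem expr_add {γ b : ℝ} {u v : CInfty} (hu : InDomain γ b u) (hv : InDomain γ b v) {x : ℝ}
    (hx : 0 ≤ x) : expr γ b (u + v) x = expr γ b u x + expr γ b v x := by
  unfold expr
  rw [hu.mul_d1_add hv hx]
  rcases hx.eq_or_lt with rfl | hx
  · simp
  · rw [d2_add hu.contDiffOn_two hv.contDiffOn_two hx]
    ring

theorem expr_smul {γ b : ℝ} (c : ℂ) {u : CInfty} (hu : InDomain γ b u) {x : ℝ} (hx : 0 ≤ x) :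
    expr γ b (c • u) x = c * expr γ b u x := by
  unfold expr
  rw [hu.mul_d1_smul c hx]
  rcases hx.eq_or_lt with rfl | hx
  · simp
  · rw [d2_smul c hu.contDiffOn_two hx]
    ring

theorem ext_zero : ext 0 = 0 := rfl

theorem d2_zero (x : ℝ) : d2 0 x = 0 := by
  simp [d2, ext_zero]

theorem expr_zero (γ b x : ℝ) : expr γ b 0 x = 0 := by
  simp [expr, d2, d1, ext_zero]

theorem InDomain.zero (γ b : ℝ) : InDomain γ b 0 where
  contDiffOn_two := by rw [ext_zero]; exact contDiffOn_const
  tendsto_atTop := by simp [funext (expr_zero γ b)]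
  tendsto_zero_of_eq _ := by simp [funext (expr_zero γ b)]
  contDiffOn_one _ := by rw [ext_zero]; exact contDiffOn_const
  tendsto_zero_of_ne _ := by simp [d2_zero]

theorem InDomain.add {γ b : ℝ} {u v : CInfty} (hu : InDomain γ b u) (hv : InDomain γ b v) :
    InDomain γ b (u + v) where
  contDiffOn_two := hu.contDiffOn_two.add hv.contDiffOn_two
  tendsto_atTop := by
    have h := hu.tendsto_atTop.add hv.tendsto_atTop
    rw [add_zero] at h
    refine h.congr' ?_
    filter_upwards [eventually_ge_atTop 0] with x hx
    exact (expr_add hu hv hx).symm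
  tendsto_zero_of_eq hb := by
    have h := (hu.tendsto_zero_of_eq hb).add (hv.tendsto_zero_of_eq hb)
    rw [add_zero] at h
    refine h.congr' ?_
    filter_upwards [self_mem_nhdsWithin] with x hx
    exact (expr_add hu hv (le_of_lt hx)).symm
  contDiffOn_one hb := (hu.contDiffOn_one hb).add (hv.contDiffOn_one hb)
  tendsto_zero_of_ne hb := by
    have h := (hu.tendsto_zero_of_ne hb).add (hv.tendsto_zero_of_ne hb)
    rw [add_zero] at h
    refine h.congr' ?_
    filter_upwards [self_mem_nhdsWithin] with x hx
    rw [d2_add hu.contDiffOn_two hv.contDiffOn_two hx, mul_add]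

theorem InDomain.smul {γ b : ℝ} (c : ℂ) {u : CInfty} (hu : InDomain γ b u) :
    InDomain γ b (c • u) where
  contDiffOn_two := contDiffOn_const.smul hu.contDiffOn_two
  tendsto_atTop := by
    have h := hu.tendsto_atTop.const_mul c
    rw [mul_zero] at h
    refine h.congr' ?_
    filter_upwards [eventually_ge_atTop 0] with x hx
    exact (expr_smul c hu hx).symm
  tendsto_zero_of_eq hb := by
    have h := (hu.tendsto_zero_of_eq hb).const_mul c
    rw [mul_zero] at h
    refine h.congr' ?_
    filter_upwards [self_mem_nhdsWithin] with x hx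
    exact (expr_smul c hu (le_of_lt hx)).symm
  contDiffOn_one hb := contDiffOn_const.smul (hu.contDiffOn_one hb)
  tendsto_zero_of_ne hb := by
    have h := (hu.tendsto_zero_of_ne hb).const_mul c
    rw [mul_zero] at h
    refine h.congr' ?_
    filter_upwards [self_mem_nhdsWithin] with x hx
    rw [d2_smul c hu.contDiffOn_two hx]
    ring

/-- For `u ∈ D(A^{γ,b})` the function `γ x u'' + b u'` is continuous on `[0,∞[`. -/
theorem InDomain.continuousOn_expr {γ b : ℝ} {u : CInfty} (hu : InDomain γ b u) :
    ContinuousOn (expr γ b u) (Ici 0) := by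
  intro x hx
  rcases (mem_Ici.1 hx).eq_or_lt with rfl | hx
  · rw [← continuousWithinAt_Ioi_iff_Ici]
    unfold ContinuousWithinAt
    by_cases hb : b = 0
    · have h := hu.tendsto_zero_of_eq hb
      have h0 : expr γ b u 0 = 0 := by simp [expr, hb]
      rwa [h0]
    · have h1 := (hu.tendsto_zero_of_ne hb).const_mul (γ : ℂ)
      have h2 : ContinuousWithinAt (d1 u) (Ici 0) 0 :=
        (hu.contDiffOn_one hb).continuousOn_derivWithin (uniqueDiffOn_Ici 0) le_rfl 0
          self_mem_Ici
      have h3 : Tendsto (d1 u) (𝓝[>] 0) (𝓝 (d1 u 0)) := h2.mono Ioi_subset_Ici_self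
      have h4 := h1.add (h3.const_mul (b : ℂ))
      have h0 : expr γ b u 0 = (γ : ℂ) * 0 + b * d1 u 0 := by simp [expr]
      rw [h0]
      refine h4.congr fun x => ?_
      simp only [expr]
      ring
  · apply ContinuousAt.continuousWithinAt
    have h1 : ContinuousAt (deriv (ext u)) x :=
      (differentiableAt_deriv hu.contDiffOn_two hx).continuousAt
    have h1' : ContinuousAt (d1 u) x := by
      refine h1.congr ?_
      filter_upwards [Ioi_mem_nhds hx] with y hy
      exact (d1_eq_deriv u hy).symm
    have h2 : ContinuousAt (d2 u) x :=
      ((contDiffOn_deriv hu.contDiffOn_two).continuousOn_deriv_of_isOpen isOpen_Ioi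
        le_rfl).continuousAt (Ioi_mem_nhds hx)
    have h3 : ContinuousAt (fun y : ℝ => (y : ℂ)) x := Complex.continuous_ofReal.continuousAt
    exact ((continuousAt_const.mul h3).mul h2).add (continuousAt_const.mul h1')

/-- For `u ∈ D(A^{γ,b})`, the function `γ x u'' + b u'` as an element of `C([0,∞])`. -/
def image (γ b : ℝ) (u : CInfty) (hu : InDomain γ b u) : CInfty :=
  ⟨ZeroAtInftyContinuousMap.toBCF
    { toFun := fun x : ℝ≥0 => expr γ b u (x : ℝ)
      continuous_toFun :=
        hu.continuousOn_expr.comp_continuous NNReal.continuous_coe fun x => x.2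
      zero_at_infty' := by
        rw [cocompact_eq_atTop]
        exact hu.tendsto_atTop.comp (NNReal.tendsto_coe_atTop.2 tendsto_id) },
   0, hu.tendsto_atTop.comp (NNReal.tendsto_coe_atTop.2 tendsto_id)⟩

/-- The unbounded operator `A^{γ,b} u = γ x u'' + b u'` in `C([0,∞])` with domain
`D(A^{γ,b})`. -/
def A (γ b : ℝ) : CInfty →ₗ.[ℂ] CInfty where
  domain :=
    { carrier := {u | InDomain γ b u}
      zero_mem' := InDomain.zero γ b
      add_mem' := InDomain.add
      smul_mem' := fun c _ hu => InDomain.smul c hu }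
  toFun :=
    { toFun := fun u => image γ b u.1 u.2
      map_add' := fun u v => by
        ext x
        exact expr_add u.2 v.2 x.2
      map_smul' := fun c u => by
        ext x
        exact expr_smul c u.2 x.2 }

/-- `R` is a bounded everywhere defined two-sided inverse of `λ - T : D(T) → E`. -/
def IsResolventAt {E : Type*} [NormedAddCommGroup E] [NormedSpace ℂ E] (T : E →ₗ.[ℂ] E)
    (lam : ℂ) (R : E →L[ℂ] E) : Prop :=
  (∀ f : E, ∃ h : R f ∈ T.domain, lam • R f - T ⟨R f, h⟩ = f) ∧
    ∀ u : T.domain, R (lam • (u : E) - T u) = u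

theorem IsResolventAt.unique {E : Type*} [NormedAddCommGroup E] [NormedSpace ℂ E]
    {T : E →ₗ.[ℂ] E} {lam : ℂ} {R S : E →L[ℂ] E} (hR : IsResolventAt T lam R)
    (hS : IsResolventAt T lam S) : R = S := by
  ext f
  obtain ⟨h, hf⟩ := hR.1 f
  have h' := hS.2 ⟨R f, h⟩
  simp only [hf] at h'
  exact h'.symm

/-- The resolvent set `ρ(T)` of an unbounded operator. -/
def resolventSet {E : Type*} [NormedAddCommGroup E] [NormedSpace ℂ E] (T : E →ₗ.[ℂ] E) :
    Set ℂ :=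
  {lam | ∃ R : E →L[ℂ] E, IsResolventAt T lam R}

open Classical in
/-- The resolvent operator `R(λ, T) = (λ - T)⁻¹` for `λ ∈ ρ(T)` (by convention `0` if
`λ ∉ ρ(T)`). -/
def resolvent {E : Type*} [NormedAddCommGroup E] [NormedSpace ℂ E] (T : E →ₗ.[ℂ] E)
    (lam : ℂ) : E →L[ℂ] E :=
  if h : ∃ R : E →L[ℂ] E, IsResolventAt T lam R then h.choose else 0

end DegenerateDiffusion

end

/-! Put `β = b / γ` and write `λ = γ q²` with `Re q > 0`. The resolvent equation becomes `x u'' + β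
u' = q² u - f / γ`. Its homogeneous solutions are of modified Bessel type: `regSol`, regular at the
origin, and `besselK`, decaying at infinity. Their weighted Wronskian is the constant `q ^ (1 - β)`
(`wronsk_eq`), so variation of parameters gives an explicit inverse, `green`.

The estimate compares the complex `q` with the real number `r = Re q`. Both solutions come from
integrals against positive weights, whence `|besselK β q| ≤ besselKReal β r` (`norm_besselK_le`) and
`|regSol β q| ≤ κ² regSolReal β r` with `κ = |q| / r` (`norm_besselI_sq_mul_le`). For real `r` the
Green densities have explicit primitives, and the resulting terms add up to the real Wronskian.
Hence `green` has norm at most `κ ^ (β + 3) / |q|²` (`norm_green_le`). Since `κ = 1 / cos (arg λ /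
2)` is bounded for `|arg λ| ≤ π/2 + θ` as soon as `θ < π/2`, and `β ≤ B / γ₀`, the constant is
uniform.

The boundary conditions complete the argument. The Green operator acts on `f / γ` minus its limit at
infinity, and the constant part is solved by hand. If `β = 0`, a multiple of `besselK` corrects the
value at the origin. If `β > 0`, the first-order equation for `u'` forces `u'` to have exactly the
limit that makes `x u''` vanish (`exists_tendsto_of_ode`). Uniqueness (`eq_zero_of_homogeneous`)
holds because the weighted Wronskians of a bounded solution with the two basic ones are constants,
killed by the decay at infinity and by the condition at the origin. -/

namespace BesselKernel

open MeasureTheory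
open scoped Nat

/-! ### The Bessel series: coefficients, derivative, contiguity relation -/

/-- The coefficients `1 / (n! Γ(n + β))` of the normalized modified Bessel series. -/
noncomputable def coeff (β : ℝ) (n : ℕ) : ℝ := ((n ! : ℝ) * Real.Gamma (n + β))⁻¹

/-- The entire function `∑ wⁿ / (n! Γ(n + β))`, that is `w ^ ((1 - β) / 2) I_{β - 1}(2 √w)`. -/
noncomputable def besselI {𝕜 : Type*} [RCLike 𝕜] (β : ℝ) (w : 𝕜) : 𝕜 :=
  ∑' n, (coeff β n : 𝕜) * w ^ n

theorem coeff_nonneg {β : ℝ} (hβ : 0 ≤ β) (n : ℕ) : 0 ≤ coeff β n :=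
  inv_nonneg.2 (mul_nonneg (by positivity) (Real.Gamma_nonneg_of_nonneg (by positivity)))

/-- The index is shifted because `coeff 0 0 = 0`: with `Real.Gamma 0 = 0` and `0⁻¹ = 0` the default
values agree with the entire function `1 / Γ`, so `β = 0` needs no separate series. -/
theorem coeff_pos {β : ℝ} (hβ : 0 ≤ β) (n : ℕ) : 0 < coeff β (n + 1) :=
  inv_pos.2 (mul_pos (by positivity) (Real.Gamma_pos_of_pos (by positivity)))

/-- This makes termwise differentiation raise the parameter `β` by one. -/
theorem succ_mul_coeff (β : ℝ) (n : ℕ) : (n + 1) * coeff β (n + 1) = coeff (β + 1) n := by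
  unfold coeff
  rw [Nat.factorial_succ, show ((n + 1 : ℕ) : ℝ) + β = n + (β + 1) by push_cast; ring]
  have : (n : ℝ) + 1 ≠ 0 := by positivity
  push_cast
  field_simp

theorem add_mul_coeff {β : ℝ} (hβ : 0 ≤ β) (n : ℕ) :
    (n + β) * coeff (β + 1) n = coeff β n := by
  unfold coeff
  rw [← add_assoc]
  by_cases h : (n : ℝ) + β = 0
  · simp [h, Real.Gamma_zero]
  · rw [Real.Gamma_add_one h]
    have hn : (n ! : ℝ) ≠ 0 := by positivity
    have hG : Real.Gamma (n + β) ≠ 0 :=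
      (Real.Gamma_pos_of_pos (lt_of_le_of_ne (by positivity) (Ne.symm h))).ne'
    field_simp

section Series

variable {𝕜 : Type*} [RCLike 𝕜]

theorem summable_besselI {β : ℝ} (hβ : 0 ≤ β) (w : 𝕜) :
    Summable fun n => (coeff β n : 𝕜) * w ^ n := by
  refine summable_of_ratio_norm_eventually_le (r := 1 / 2) (by norm_num) ?_
  obtain ⟨N, hN⟩ := exists_nat_ge (2 * ‖w‖)
  filter_upwards [eventually_ge_atTop N, eventually_ge_atTop 1] with n hn h1
  have h1' : (1 : ℝ) ≤ n := by exact_mod_cast h1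
  have hn' : 2 * ‖w‖ ≤ n := hN.trans (by exact_mod_cast hn)
  have e := add_mul_coeff hβ n
  rw [← succ_mul_coeff] at e
  have c0 := (coeff_pos hβ n).le
  rw [norm_mul, norm_mul, norm_pow, norm_pow, pow_succ, RCLike.norm_ofReal, RCLike.norm_ofReal,
    abs_of_nonneg c0, abs_of_nonneg (coeff_nonneg hβ n), ← e]
  -- Consecutive coefficients have ratio `1 / ((n + 1) (n + β))`, so `n ≥ 2 ‖w‖` already gives ratio
  -- at most `1 / 2`.
  have : ‖w‖ ≤ 1 / 2 * ((n + β) * (n + 1)) := by nlinarith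
  calc coeff β (n + 1) * (‖w‖ ^ n * ‖w‖)
      ≤ coeff β (n + 1) * (‖w‖ ^ n * (1 / 2 * ((n + β) * (n + 1)))) := by gcongr
    _ = _ := by ring

theorem besselI_ofReal {β : ℝ} (w : ℝ) : besselI β (w : 𝕜) = (besselI β w : ℝ) := by
  simp [besselI, RCLike.ofReal_tsum]

theorem hasDerivAt_besselI {β : ℝ} (hβ : 0 ≤ β) (w : 𝕜) :
    HasDerivAt (besselI β) (besselI (β + 1) w) w := by
  have hw : w ∈ Metric.ball (0 : 𝕜) (‖w‖ + 1) := by simp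
  have key := hasDerivAt_tsum_of_isPreconnected (𝕜 := 𝕜) (F := 𝕜)
    (g := fun n z => (coeff β n : 𝕜) * z ^ n)
    (g' := fun n z => (coeff β n : 𝕜) * (n * z ^ (n - 1)))
    (u := fun n => coeff β n * (n * (‖w‖ + 1) ^ (n - 1)))
    (t := Metric.ball 0 (‖w‖ + 1)) (y₀ := w) (y := w) ?_ Metric.isOpen_ball
    (convex_ball (E := 𝕜) 0 _).isPreconnected ?_ ?_ hw (summable_besselI hβ w) hw
  · refine HasDerivAt.congr_deriv key ?_
    have hs : Summable fun n => (coeff β n : 𝕜) * (n * w ^ (n - 1)) := by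
      rw [← summable_nat_add_iff 1]
      refine (summable_besselI (𝕜 := 𝕜) (β := β + 1) (by positivity) w).congr fun n => ?_
      rw [← succ_mul_coeff, Nat.add_sub_cancel]
      push_cast
      ring
    rw [hs.tsum_eq_zero_add]
    simp only [Nat.cast_zero, zero_mul, mul_zero, zero_add, besselI]
    refine tsum_congr fun n => ?_
    rw [← succ_mul_coeff, Nat.add_sub_cancel]
    push_cast
    ring
  · rw [← summable_nat_add_iff 1]
    refine (summable_besselI (𝕜 := ℝ) (β := β + 1) (by positivity) (‖w‖ + 1)).congr fun n => ?_
    rw [← succ_mul_coeff, Nat.add_sub_cancel]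
    simp only [RCLike.ofReal_real_eq_id, id_eq]
    push_cast
    ring
  · intro n y _
    exact (hasDerivAt_pow n y).const_mul _
  · intro n y hy
    rw [norm_mul, norm_mul, norm_pow, RCLike.norm_ofReal, abs_of_nonneg (coeff_nonneg hβ n),
      RCLike.norm_natCast]
    have := coeff_nonneg hβ n
    have hy' : ‖y‖ ≤ ‖w‖ + 1 := by simpa using (mem_ball_zero_iff.1 hy).le
    gcongr

/-- Splitting the factor `n + β` in `add_mul_coeff` gives the two terms. As each derivative raises
the parameter by one, this is the differential equation `w y'' + β y' = y`. -/
theorem besselI_eq {β : ℝ} (hβ : 0 ≤ β) (w : 𝕜) :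
    besselI β w = w * besselI (β + 2) w + β * besselI (β + 1) w := by
  have h1 := summable_besselI (𝕜 := 𝕜) (β := β + 1) (by positivity) w
  have h2 := summable_besselI (𝕜 := 𝕜) (β := β + 2) (by positivity) w
  have e : ∀ n : ℕ, (coeff β n : 𝕜) * w ^ n
      = n * (coeff (β + 1) n * w ^ n) + β * (coeff (β + 1) n * w ^ n) := by
    intro n
    rw [← add_mul_coeff hβ n]
    push_cast
    ring
  have e' : ∀ n : ℕ, ((n + 1 : ℕ) : 𝕜) * (coeff (β + 1) (n + 1) * w ^ (n + 1))
      = w * (coeff (β + 2) n * w ^ n) := by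
    intro n
    have h := succ_mul_coeff (β + 1) n
    rw [show β + 1 + 1 = β + 2 by ring] at h
    rw [← h]
    push_cast
    ring
  have hs : Summable fun n : ℕ => (n : 𝕜) * (coeff (β + 1) n * w ^ n) := by
    rw [← summable_nat_add_iff 1]
    exact (h2.mul_left w).congr fun n => (e' n).symm
  unfold besselI
  rw [tsum_congr e, hs.tsum_add (h1.mul_left _), hs.tsum_eq_zero_add, tsum_congr e', tsum_mul_left,
    tsum_mul_left]
  simp

theorem continuous_besselI {β : ℝ} (hβ : 0 ≤ β) : Continuous (besselI β : 𝕜 → 𝕜) :=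
  continuous_iff_continuousAt.2 fun w => (hasDerivAt_besselI hβ w).continuousAt

end Series

theorem besselI_zero {𝕜 : Type*} [RCLike 𝕜] (β : ℝ) :
    besselI β (0 : 𝕜) = (coeff β 0 : 𝕜) := by
  unfold besselI
  rw [tsum_eq_single 0 fun n hn => by simp [hn]]
  simp

theorem besselI_nonneg {β w : ℝ} (hβ : 0 ≤ β) (hw : 0 ≤ w) : 0 ≤ besselI β w :=
  tsum_nonneg fun n => mul_nonneg (coeff_nonneg hβ n) (by positivity)

/-! ### Poisson representation and comparison of complex with real arguments -/

/-- The beta integral in the form used for the Poisson representation. -/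
theorem integral_poisson_weight {β : ℝ} (hβ : 1 ≤ β) (n : ℕ) :
    IntegrableOn (fun s : ℝ => s ^ (n : ℝ) * (s ^ (-1 / 2 : ℝ) * (1 - s) ^ (β - 3 / 2))) (Ioo 0 1) ∧
    ∫ s in Ioo (0 : ℝ) 1, s ^ (n : ℝ) * (s ^ (-1 / 2 : ℝ) * (1 - s) ^ (β - 3 / 2))
      = Real.Gamma (n + 1 / 2) * Real.Gamma (β - 1 / 2) / Real.Gamma (n + β) := by
  have hu : 0 < ((n + 1 / 2 : ℝ) : ℂ).re := by rw [Complex.ofReal_re]; positivity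
  have hv : 0 < ((β - 1 / 2 : ℝ) : ℂ).re := by rw [Complex.ofReal_re]; linarith
  have hc := Complex.betaIntegral_convergent hu hv
  rw [intervalIntegrable_iff_integrableOn_Ioo_of_le zero_le_one] at hc
  have he : ∀ s ∈ Ioo (0 : ℝ) 1, (s : ℂ) ^ (((n + 1 / 2 : ℝ) : ℂ) - 1)
      * (1 - (s : ℂ)) ^ (((β - 1 / 2 : ℝ) : ℂ) - 1)
      = ((s ^ (n : ℝ) * (s ^ (-1 / 2 : ℝ) * (1 - s) ^ (β - 3 / 2)) : ℝ) : ℂ) := by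
    intro s hs
    rw [← mul_assoc, ← Real.rpow_add hs.1, Complex.ofReal_mul, Complex.ofReal_cpow hs.1.le,
      Complex.ofReal_cpow (by linarith [hs.2])]
    push_cast
    ring_nf
  have hc' := (hc.congr_fun he measurableSet_Ioo)
  refine ⟨hc'.re, ?_⟩
  have hG := Complex.betaIntegral_eq_Gamma_mul_div _ _ hu hv
  rw [Complex.betaIntegral, intervalIntegral.integral_of_le zero_le_one,
    integral_Ioc_eq_integral_Ioo, setIntegral_congr_fun measurableSet_Ioo he, integral_complex_ofReal,
    ← Complex.ofReal_add, Complex.Gamma_ofReal, Complex.Gamma_ofReal, Complex.Gamma_ofReal] at hG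
  have : (n : ℝ) + 1 / 2 + (β - 1 / 2) = n + β := by ring
  rw [this] at hG
  exact_mod_cast hG

/-- The duplication formula at half-integers; it turns the factor `1 / (2n)!` of the `cosh` series
into the factor `1 / n!` of the Bessel series. -/
theorem Gamma_nat_add_half' (n : ℕ) :
    Real.Gamma (n + 1 / 2) * 4 ^ n / (2 * n)! = √Real.pi / n ! := by
  induction n with
  | zero => simpa using Real.Gamma_one_half_eq
  | succ n ih =>
    rw [show ((n + 1 : ℕ) : ℝ) + 1 / 2 = (n + 1 / 2) + 1 by push_cast; ring,
      Real.Gamma_add_one (by positivity), show 2 * (n + 1) = 2 * n + 1 + 1 by ring,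
      Nat.factorial_succ, Nat.factorial_succ, Nat.factorial_succ n, pow_succ]
    have h2 : ((2 * n)! : ℝ) ≠ 0 := by positivity
    have h3 : (n ! : ℝ) ≠ 0 := by positivity
    push_cast
    field_simp at ih ⊢
    linear_combination 4 * ((n : ℝ) + 1) * ih

/-- The Poisson representation of `besselI`. -/
theorem besselI_eq_integral {β : ℝ} (hβ : 1 ≤ β) (q : ℂ) :
    besselI β (q ^ 2) * ((√Real.pi * Real.Gamma (β - 1 / 2) : ℝ) : ℂ)
      = ∫ s in Ioo (0 : ℝ) 1, ((s ^ (-1 / 2 : ℝ) * (1 - s) ^ (β - 3 / 2) : ℝ) : ℂ)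
        * Complex.cosh (2 * q * √s) := by
  set c : ℝ := √Real.pi * Real.Gamma (β - 1 / 2) with hc
  have hcpos : 0 < c := mul_pos (by positivity) (Real.Gamma_pos_of_pos (by linarith))
  -- `F n` is the weight times the `n`-th term of `cosh (2 q √s)`, with the power `s ^ n` moved into
  -- the beta integral.
  set F : ℕ → ℝ → ℂ := fun n s =>
    ((s ^ (n : ℝ) * (s ^ (-1 / 2 : ℝ) * (1 - s) ^ (β - 3 / 2)) : ℝ) : ℂ)
      * ((4 : ℂ) ^ n * q ^ (2 * n) / (2 * n)!) with hF
  have hFi : ∀ n, IntegrableOn (F n) (Ioo 0 1) := fun n =>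
    ((integral_poisson_weight hβ n).1.ofReal).mul_const _
  have key : ∀ n : ℕ, Real.Gamma (n + 1 / 2) * Real.Gamma (β - 1 / 2) / Real.Gamma (n + β)
      * (4 ^ n / (2 * n)!) = c * coeff β n := by
    intro n
    have := Gamma_nat_add_half' n
    rw [show Real.Gamma (n + 1 / 2) * Real.Gamma (β - 1 / 2) / Real.Gamma (n + β)
      * (4 ^ n / (2 * n)!) = (Real.Gamma (n + 1 / 2) * 4 ^ n / (2 * n)!) *
        (Real.Gamma (β - 1 / 2) / Real.Gamma (n + β)) by ring, this, hc, coeff]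
    field_simp
  have hFint : ∀ n, ∫ s in Ioo (0 : ℝ) 1, F n s = (coeff β n : ℂ) * (q ^ 2) ^ n * c := by
    intro n
    rw [hF]
    simp only
    rw [integral_mul_const, integral_complex_ofReal, (integral_poisson_weight hβ n).2, mul_div_assoc,
      mul_comm (coeff β n : ℂ), mul_assoc, ← Complex.ofReal_mul, mul_comm (coeff β n), ← key n,
      ← pow_mul]
    push_cast
    ring
  have hFnorm : ∀ n, ∫ s in Ioo (0 : ℝ) 1, ‖F n s‖ = c * ‖(coeff β n : ℂ) * (q ^ 2) ^ n‖ := by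
    intro n
    have : ∀ s ∈ Ioo (0 : ℝ) 1, ‖F n s‖ = s ^ (n : ℝ) * (s ^ (-1 / 2 : ℝ) * (1 - s) ^ (β - 3 / 2))
        * (4 ^ n * ‖q‖ ^ (2 * n) / (2 * n)!) := by
      intro s hs
      have h1 : 0 ≤ 1 - s := by linarith [hs.2]
      have h2 := hs.1.le
      rw [hF]
      simp only
      rw [norm_mul, Complex.norm_real, Real.norm_of_nonneg (by positivity)]
      simp
    rw [setIntegral_congr_fun measurableSet_Ioo this, integral_mul_const,
      (integral_poisson_weight hβ n).2, norm_mul, Complex.norm_real,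
      Real.norm_of_nonneg (coeff_nonneg (by linarith) n), ← mul_assoc, ← key n, norm_pow, norm_pow,
      ← pow_mul]
    ring
  -- Sum and integral may be exchanged because the `L¹` norms are, up to the factor `c`, the norms
  -- of the terms of the Bessel series.
  have hFs : Summable fun n => ∫ s in Ioo (0 : ℝ) 1, ‖F n s‖ := by
    simp only [hFnorm]
    exact (summable_besselI (𝕜 := ℂ) (by linarith : 0 ≤ β) (q ^ 2)).norm.mul_left c
  have hsum := hasSum_integral_of_summable_integral_norm (μ := volume.restrict (Ioo (0 : ℝ) 1)) hFi
    hFs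
  have h2 : HasSum (fun n => (coeff β n : ℂ) * (q ^ 2) ^ n * c) (besselI β (q ^ 2) * c) :=
    (summable_besselI (𝕜 := ℂ) (by linarith : 0 ≤ β) (q ^ 2)).hasSum.mul_right (c : ℂ)
  simp only [hFint] at hsum
  refine (h2.unique hsum).trans (setIntegral_congr_fun measurableSet_Ioo fun s hs => ?_)
  have h3 := (Complex.hasSum_cosh (2 * q * √s)).mul_left
    ((s ^ (-1 / 2 : ℝ) * (1 - s) ^ (β - 3 / 2) : ℝ) : ℂ)
  refine Eq.trans (tsum_congr fun n => ?_) h3.tsum_eq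
  have h4 : (2 * q * √s) ^ (2 * n) = 4 ^ n * q ^ (2 * n) * (s : ℂ) ^ n := by
    have : ((√s : ℝ) : ℂ) ^ (2 * n) = (s : ℂ) ^ n := by
      rw [pow_mul, ← Complex.ofReal_pow, Real.sq_sqrt hs.1.le]
    rw [mul_pow, mul_pow, this, pow_mul]
    norm_num
  simp only [hF]
  rw [h4, Real.rpow_natCast]
  push_cast
  ring

theorem norm_cosh_le (z : ℂ) : ‖Complex.cosh z‖ ≤ Real.cosh z.re := by
  rw [Complex.cosh, Real.cosh_eq, norm_div, Complex.norm_ofNat]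
  gcongr
  refine (norm_add_le _ _).trans ?_
  simp [Complex.norm_exp]

/-- The Poisson weight is nonnegative and `|cosh z| ≤ cosh (Re z)`, so taking norms under the
integral replaces `q` by its real part. -/
theorem norm_besselI_sq_le_of_one_le {β : ℝ} (hβ : 1 ≤ β) (q : ℂ) :
    ‖besselI β (q ^ 2)‖ ≤ besselI β (q.re ^ 2) := by
  set c : ℝ := √Real.pi * Real.Gamma (β - 1 / 2) with hc
  have hcpos : 0 < c := mul_pos (by positivity) (Real.Gamma_pos_of_pos (by linarith))
  have h0 := (integral_poisson_weight hβ 0).1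
  simp only [Nat.cast_zero, Real.rpow_zero, one_mul] at h0
  have hr := besselI_eq_integral hβ (q.re : ℂ)
  rw [← hc] at hr
  have hr' : besselI β (q.re ^ 2) * c = ∫ s in Ioo (0 : ℝ) 1,
      (s ^ (-1 / 2 : ℝ) * (1 - s) ^ (β - 3 / 2)) * Real.cosh (2 * q.re * √s) := by
    rw [← Complex.ofReal_inj, ← integral_complex_ofReal]
    push_cast
    rw [← Complex.ofReal_pow] at hr
    have e := besselI_ofReal (𝕜 := ℂ) (β := β) (q.re ^ 2)
    simp only [Complex.coe_algebraMap] at e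
    rw [e] at hr
    convert hr using 1
    push_cast
    rfl
  have hi : IntegrableOn (fun s : ℝ => (s ^ (-1 / 2 : ℝ) * (1 - s) ^ (β - 3 / 2))
      * Real.cosh (2 * q.re * √s)) (Ioo 0 1) := by
    refine h0.mul_bdd (c := Real.cosh (2 * q.re)) (by fun_prop) ?_
    refine (ae_restrict_mem measurableSet_Ioo).mono fun s hs => ?_
    rw [Real.norm_of_nonneg (Real.cosh_pos _).le, Real.cosh_le_cosh, abs_mul,
      abs_of_nonneg (Real.sqrt_nonneg s)]
    exact mul_le_of_le_one_right (abs_nonneg _) (Real.sqrt_le_one.2 hs.2.le)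
  have := norm_integral_le_of_norm_le (f := fun s : ℝ =>
    ((s ^ (-1 / 2 : ℝ) * (1 - s) ^ (β - 3 / 2) : ℝ) : ℂ) * Complex.cosh (2 * q * √s)) hi (by
      refine (ae_restrict_mem measurableSet_Ioo).mono fun s hs => ?_
      have h1 : 0 ≤ 1 - s := by linarith [hs.2]
      have h2 := hs.1.le
      rw [norm_mul, Complex.norm_real, Real.norm_of_nonneg (by positivity)]
      gcongr
      exact (norm_cosh_le _).trans_eq (by simp))
  rw [← besselI_eq_integral hβ q, ← hr', norm_mul, ← hc, Complex.norm_real,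
    Real.norm_of_nonneg hcpos.le] at this
  exact le_of_mul_le_mul_right this hcpos

/-- Comparison of `besselI` at complex arguments with its values on the positive half-line. -/
theorem norm_besselI_sq_mul_le {β : ℝ} (hβ : 0 ≤ β) {q : ℂ} (hq : 0 < q.re) {x : ℝ} (hx : 0 ≤ x) :
    ‖besselI β (q ^ 2 * x)‖ ≤ (‖q‖ / q.re) ^ 2 * besselI β (q.re ^ 2 * x) := by
  have hb : ∀ α : ℝ, 1 ≤ α → ‖besselI α (q ^ 2 * x)‖ ≤ besselI α (q.re ^ 2 * x) := by
    intro α hα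
    have h := norm_besselI_sq_le_of_one_le hα (q * (√x : ℝ))
    rw [mul_pow, ← Complex.ofReal_pow, Real.sq_sqrt hx] at h
    simpa [mul_pow, Real.sq_sqrt hx] using h
  have h1 : 1 ≤ ‖q‖ / q.re := by
    rw [one_le_div hq]
    exact (le_abs_self _).trans (Complex.abs_re_le_norm q)
  have h1' : 1 ≤ (‖q‖ / q.re) ^ 2 := one_le_pow₀ h1
  have e := besselI_eq (𝕜 := ℝ) hβ (q.re ^ 2 * x)
  simp only [RCLike.ofReal_real_eq_id, id_eq] at e
  -- The Poisson weight is not integrable for small `β`, so the contiguity relation passes to the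
  -- parameters `β + 1` and `β + 2`. The price is the factor `‖q‖² / (Re q)²` coming from the
  -- coefficient `w = q² x`.
  rw [besselI_eq hβ, e]
  refine (norm_add_le _ _).trans ?_
  rw [norm_mul, norm_mul, norm_mul, norm_pow, Complex.norm_real, Real.norm_of_nonneg hx]
  have hb' : ‖((β : ℝ) : ℂ)‖ = β := by simp [abs_of_nonneg hβ]
  rw [RCLike.ofReal_eq_complex_ofReal, hb', mul_add]
  have i1 := hb (β + 1) (by linarith)
  have i2 := hb (β + 2) (by linarith)
  have p1 : 0 ≤ besselI (β + 1) (q.re ^ 2 * x) := besselI_nonneg (by linarith) (by positivity)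
  gcongr ?_ + ?_
  · calc ‖q‖ ^ 2 * x * ‖besselI (β + 2) (q ^ 2 * x)‖
        ≤ ‖q‖ ^ 2 * x * besselI (β + 2) (q.re ^ 2 * x) := by gcongr
      _ = _ := by field_simp
  · calc β * ‖besselI (β + 1) (q ^ 2 * x)‖
        ≤ 1 * (β * besselI (β + 1) (q.re ^ 2 * x)) := by rw [one_mul]; gcongr
      _ ≤ _ := by gcongr

/-! ### The Gamma integral with complex rate -/

section GammaIntegral

theorem integrableOn_rpow_mul_exp_neg {a : ℝ} (ha : -1 < a) {r : ℝ} (hr : 0 < r) :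
    IntegrableOn (fun s : ℝ => s ^ a * Real.exp (-r * s)) (Ioi 0) := by
  simpa using integrableOn_rpow_mul_exp_neg_mul_rpow ha one_pos hr

theorem norm_ofReal_mul_cexp {s : ℝ} (hs : 0 < s) (a : ℝ) (z : ℂ) :
    ‖((s ^ a : ℝ) : ℂ) * Complex.exp z‖ = s ^ a * Real.exp z.re := by
  rw [norm_mul, Complex.norm_real, Real.norm_of_nonneg (by positivity), Complex.norm_exp]

theorem integrableOn_rpow_mul_cexp_neg {a : ℝ} (ha : -1 < a) {q : ℂ} (hq : 0 < q.re) :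
    IntegrableOn (fun s : ℝ => ((s ^ a : ℝ) : ℂ) * Complex.exp (-q * s)) (Ioi 0) := by
  refine Integrable.mono' (integrableOn_rpow_mul_exp_neg ha hq) ?_ ?_
  · exact Measurable.aestronglyMeasurable (by fun_prop)
  · refine (ae_restrict_mem measurableSet_Ioi).mono fun s hs => ?_
    rw [norm_ofReal_mul_cexp hs]
    simp

theorem hasDerivAt_ofReal_rpow {s : ℝ} (hs : 0 < s) (a : ℝ) :
    HasDerivAt (fun t : ℝ => ((t ^ a : ℝ) : ℂ)) ((a * s ^ (a - 1) : ℝ) : ℂ) s :=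
  (Real.hasDerivAt_rpow_const (Or.inl hs.ne')).ofReal_comp

theorem tendsto_rpow_nhdsGT_zero {a : ℝ} (ha : 0 < a) :
    Tendsto (fun x : ℝ => x ^ a) (𝓝[>] 0) (𝓝 0) := by
  have := (Real.continuous_rpow_const ha.le).tendsto 0
  rw [Real.zero_rpow ha.ne'] at this
  exact this.mono_left nhdsWithin_le_nhds

theorem mul_integral_rpow_mul_cexp_neg {a : ℝ} (ha : 0 < a) {q : ℂ} (hq : 0 < q.re) :
    q * ∫ s : ℝ in Ioi 0, ((s ^ a : ℝ) : ℂ) * Complex.exp (-q * s)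
      = a * ∫ s : ℝ in Ioi 0, ((s ^ (a - 1) : ℝ) : ℂ) * Complex.exp (-q * s) := by
  have i1 := integrableOn_rpow_mul_cexp_neg (by linarith : -1 < a) hq
  have i2 := integrableOn_rpow_mul_cexp_neg (by linarith : -1 < a - 1) hq
  have hv : ∀ s ∈ Ioi (0 : ℝ), HasDerivAt (fun t : ℝ => Complex.exp (-q * t))
      (-q * Complex.exp (-q * s)) s := by
    intro s _
    have : HasDerivAt (fun t : ℝ => -q * (t : ℂ)) (-q * 1) s :=
      (HasDerivAt.ofReal_comp (hasDerivAt_id s)).const_mul _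
    convert this.cexp using 1
    ring
  have key := integral_Ioi_mul_deriv_eq_deriv_mul (a := 0) (a' := 0) (b' := 0)
    (fun s hs => hasDerivAt_ofReal_rpow hs a) hv ?_ ?_ ?_ ?_
  · have e1 : ∀ s : ℝ, ((s ^ a : ℝ) : ℂ) * (-q * Complex.exp (-q * s))
        = -q * (((s ^ a : ℝ) : ℂ) * Complex.exp (-q * s)) := fun s => by ring
    have e2 : ∀ s : ℝ, ((a * s ^ (a - 1) : ℝ) : ℂ) * Complex.exp (-q * s)
        = a * (((s ^ (a - 1) : ℝ) : ℂ) * Complex.exp (-q * s)) := fun s => by push_cast; ring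
    simp only [e1, e2, integral_const_mul] at key
    linear_combination -key
  · refine IntegrableOn.congr_fun (i1.const_mul (-q)) (fun s _ => ?_) measurableSet_Ioi
    simp only [Pi.mul_apply]
    ring
  · refine IntegrableOn.congr_fun (i2.const_mul (a : ℂ)) (fun s _ => ?_) measurableSet_Ioi
    simp only [Pi.mul_apply]
    push_cast
    ring
  · rw [tendsto_zero_iff_norm_tendsto_zero]
    refine squeeze_zero' (Eventually.of_forall fun _ => norm_nonneg _) ?_
      (tendsto_rpow_nhdsGT_zero ha)
    filter_upwards [self_mem_nhdsWithin] with s hs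
    rw [Pi.mul_apply, norm_ofReal_mul_cexp hs]
    have : (-q * s).re ≤ 0 := by
      have := mul_pos hq (mem_Ioi.1 hs)
      simp
      linarith
    exact mul_le_of_le_one_right (Real.rpow_nonneg (le_of_lt hs) _) (Real.exp_le_one_iff.2 this)
  · rw [tendsto_zero_iff_norm_tendsto_zero]
    refine (tendsto_rpow_mul_exp_neg_mul_atTop_nhds_zero a q.re hq).congr' ?_
    filter_upwards [eventually_gt_atTop 0] with s hs
    rw [Pi.mul_apply, norm_ofReal_mul_cexp hs]
    simp

theorem hasDerivAt_integral_rpow_mul_cexp_neg {a : ℝ} (ha : 0 < a) {q : ℂ} (hq : 0 < q.re) :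
    HasDerivAt (fun z : ℂ => ∫ s : ℝ in Ioi 0, ((s ^ (a - 1) : ℝ) : ℂ) * Complex.exp (-z * s))
      (-∫ s : ℝ in Ioi 0, ((s ^ a : ℝ) : ℂ) * Complex.exp (-q * s)) q := by
  have hs : {z : ℂ | q.re / 2 < z.re} ∈ 𝓝 q :=
    (isOpen_lt continuous_const Complex.continuous_re).mem_nhds (by
      show q.re / 2 < q.re
      linarith)
  rw [← integral_neg]
  refine (hasDerivAt_integral_of_dominated_loc_of_deriv_le hs
    (μ := volume.restrict (Ioi (0 : ℝ)))
    (F := fun z s => ((s ^ (a - 1) : ℝ) : ℂ) * Complex.exp (-z * s))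
    (F' := fun z s => -(((s ^ a : ℝ) : ℂ) * Complex.exp (-z * s)))
    (bound := fun s => s ^ a * Real.exp (-(q.re / 2) * s)) ?_
    (integrableOn_rpow_mul_cexp_neg (by linarith) hq) ?_ ?_
    (integrableOn_rpow_mul_exp_neg (by linarith) (by positivity)) ?_).2
  · exact Eventually.of_forall fun z => Measurable.aestronglyMeasurable (by fun_prop)
  · exact Measurable.aestronglyMeasurable (by fun_prop)
  · refine (ae_restrict_mem measurableSet_Ioi).mono fun s hs z hz => ?_
    rw [norm_neg, norm_ofReal_mul_cexp hs]
    have h0 : (0 : ℝ) < s := hs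
    have : (-z * s).re ≤ -(q.re / 2) * s := by
      have : q.re / 2 < z.re := hz
      simp
      nlinarith
    gcongr
  · refine (ae_restrict_mem measurableSet_Ioi).mono fun s hs z _ => ?_
    have h0 : (0 : ℝ) < s := hs
    have h1 : HasDerivAt (fun z : ℂ => -z * (s : ℂ)) (-1 * (s : ℂ)) z :=
      (hasDerivAt_id z).neg.mul_const _
    convert! h1.cexp.const_mul ((s ^ (a - 1) : ℝ) : ℂ) using 1
    rw [Real.rpow_sub_one h0.ne']
    have : (s : ℂ) ≠ 0 := by exact_mod_cast h0.ne'
    push_cast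
    field_simp

/-- The Gamma integral with a complex rate. -/
theorem integral_rpow_mul_cexp_neg {a : ℝ} (ha : 0 < a) {q : ℂ} (hq : 0 < q.re) :
    ∫ s : ℝ in Ioi 0, ((s ^ (a - 1) : ℝ) : ℂ) * Complex.exp (-q * s)
      = Real.Gamma a * q ^ (-a : ℂ) := by
  set G : ℂ → ℂ := fun z => ∫ s : ℝ in Ioi 0, ((s ^ (a - 1) : ℝ) : ℂ) * Complex.exp (-z * s)
  have hne : ∀ z : ℂ, 0 < z.re → z ≠ 0 := by
    rintro z hz rfl
    simp at hz
  -- Integration by parts, in the form `z ∫ s ^ a e^{-zs} = a ∫ s ^ (a - 1) e^{-zs}`, says that `G z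
  -- * z ^ a` has derivative zero on the right half-plane; its constant value is read off at `z =
  -- 1`.
  have hd : ∀ z ∈ {z : ℂ | 0 < z.re}, HasDerivAt (fun z => G z * z ^ (a : ℂ)) 0 z := by
    intro z hz
    have hz' : 0 < z.re := hz
    have h1 := hasDerivAt_integral_rpow_mul_cexp_neg ha hz'
    have h2 : HasDerivAt (fun z : ℂ => z ^ (a : ℂ)) (a * z ^ ((a : ℂ) - 1) * 1) z :=
      (hasDerivAt_id z).cpow_const (Or.inl hz')
    convert! h1.mul h2 using 1
    have h3 := mul_integral_rpow_mul_cexp_neg ha hz'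
    rw [Complex.cpow_sub _ _ (hne z hz'), Complex.cpow_one]
    have := hne z hz'
    simp only [neg_mul] at h3 ⊢
    field_simp
    linear_combination z ^ (a : ℂ) * h3
  have hc := (isOpen_lt continuous_const Complex.continuous_re).is_const_of_deriv_eq_zero
    (𝕜 := ℂ) (convex_halfSpace_re_gt 0).isPreconnected
    (fun z hz => (hd z hz).differentiableAt.differentiableWithinAt) (fun z hz => (hd z hz).deriv)
    (x := q) (y := 1) hq (by simp)
  have h1 : G 1 = Real.Gamma a := by
    rw [Real.Gamma_eq_integral ha, ← integral_complex_ofReal]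
    refine setIntegral_congr_fun measurableSet_Ioi fun s _ => ?_
    push_cast
    rw [mul_comm]
    ring_nf
  rw [h1, Complex.one_cpow, mul_one] at hc
  rw [← hc, mul_assoc, ← Complex.cpow_add _ _ (hne q hq), add_neg_cancel, Complex.cpow_zero,
    mul_one]

end GammaIntegral

/-! ### The decaying solution: integrability, recurrence, reflection and decay -/

/-- The decaying solution `∫₀^∞ s^{-β} exp (-q (s + y / s)) ds`, a multiple of
`y ^ ((1 - β) / 2) K_{β - 1}(2 q √y)`. -/
noncomputable def besselK (β : ℝ) (q : ℂ) (y : ℝ) : ℂ :=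
  ∫ s : ℝ in Ioi 0, ((s ^ (-β) : ℝ) : ℂ) * Complex.exp (-q * ((s + y / s : ℝ) : ℂ))

/-- `besselK` for real parameters. -/
noncomputable def besselKReal (β r y : ℝ) : ℝ :=
  ∫ s : ℝ in Ioi 0, s ^ (-β) * Real.exp (-r * (s + y / s))

theorem besselK_ofReal (β r y : ℝ) : besselK β r y = besselKReal β r y := by
  rw [besselK, besselKReal, ← integral_complex_ofReal]
  push_cast
  rfl

theorem integrableOn_besselKReal {β r y : ℝ} (hr : 0 < r) (h : 0 < y ∨ (0 ≤ y ∧ β < 1)) :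
    IntegrableOn (fun s : ℝ => s ^ (-β) * Real.exp (-r * (s + y / s))) (Ioi 0) := by
  have hm : ∀ β : ℝ, AEStronglyMeasurable (fun s : ℝ => s ^ (-β) * Real.exp (-r * (s + y / s)))
      (volume.restrict (Ioi 0)) := fun β => Measurable.aestronglyMeasurable (by fun_prop)
  rcases h with hy | ⟨hy, hβ⟩
  -- For `y > 0` the factor `exp (-r y / s)` beats every power of `s` at the origin; `t ^ n / n! ≤
  -- exp t` with `n ≥ β` makes the exponent `n - β` nonnegative.
  · obtain ⟨n, hn⟩ := exists_nat_ge β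
    refine Integrable.mono' ((integrableOn_rpow_mul_exp_neg (a := n - β) (by linarith) hr).const_mul
      (n ! / (r * y) ^ n)) (hm β) ?_
    refine (ae_restrict_mem measurableSet_Ioi).mono fun s hs => ?_
    have h0 : (0 : ℝ) < s := hs
    rw [Real.norm_of_nonneg (by positivity)]
    have h1 := Real.pow_div_factorial_le_exp (x := r * y / s) (by positivity) n
    have h2 : Real.exp (-r * (s + y / s)) = Real.exp (-r * s) * (Real.exp (r * y / s))⁻¹ := by
      rw [← Real.exp_neg, ← Real.exp_add]
      congr 1
      field_simp
      ring
    rw [h2, Real.rpow_sub h0, Real.rpow_neg h0.le, Real.rpow_natCast]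
    calc (s ^ β)⁻¹ * (Real.exp (-r * s) * (Real.exp (r * y / s))⁻¹)
        ≤ (s ^ β)⁻¹ * (Real.exp (-r * s) * ((r * y / s) ^ n / n !)⁻¹) := by gcongr
      _ = _ := by rw [div_pow]; field_simp
  · refine Integrable.mono' (integrableOn_rpow_mul_exp_neg (a := -β) (by linarith) hr) (hm β) ?_
    refine (ae_restrict_mem measurableSet_Ioi).mono fun s hs => ?_
    have h0 : (0 : ℝ) < s := hs
    rw [Real.norm_of_nonneg (by positivity)]
    have : -r * (s + y / s) ≤ -r * s := by
      have : 0 ≤ r * (y / s) := by positivity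
      linarith
    gcongr

theorem norm_besselK_integrand {s : ℝ} (hs : 0 < s) (β : ℝ) (q : ℂ) (y : ℝ) :
    ‖((s ^ (-β) : ℝ) : ℂ) * Complex.exp (-q * ((s + y / s : ℝ) : ℂ))‖
      = s ^ (-β) * Real.exp (-q.re * (s + y / s)) := by
  rw [norm_ofReal_mul_cexp hs, Complex.re_mul_ofReal, Complex.neg_re]

theorem aestronglyMeasurable_besselK (β : ℝ) (q : ℂ) (y : ℝ) :
    AEStronglyMeasurable
      (fun s : ℝ => ((s ^ (-β) : ℝ) : ℂ) * Complex.exp (-q * ((s + y / s : ℝ) : ℂ)))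
      (volume.restrict (Ioi 0)) :=
  Measurable.aestronglyMeasurable (by fun_prop)

theorem integrableOn_besselK {β y : ℝ} {q : ℂ} (hq : 0 < q.re)
    (h : 0 < y ∨ (0 ≤ y ∧ β < 1)) :
    IntegrableOn (fun s : ℝ => ((s ^ (-β) : ℝ) : ℂ) * Complex.exp (-q * ((s + y / s : ℝ) : ℂ)))
      (Ioi 0) :=
  Integrable.mono' (integrableOn_besselKReal hq h) (aestronglyMeasurable_besselK β q y)
    ((ae_restrict_mem measurableSet_Ioi).mono fun _ hs => (norm_besselK_integrand hs β q y).le)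

/-- The quantity `s + y / s` is real and `s ^ (-β)` is positive, so only `Re q` survives in the
modulus, with no loss of constant. -/
theorem norm_besselK_le {β y : ℝ} {q : ℂ} (hq : 0 < q.re) (h : 0 < y ∨ (0 ≤ y ∧ β < 1)) :
    ‖besselK β q y‖ ≤ besselKReal β q.re y :=
  norm_integral_le_of_norm_le (integrableOn_besselKReal hq h)
    ((ae_restrict_mem measurableSet_Ioi).mono fun _ hs => (norm_besselK_integrand hs β q y).le)

theorem besselKReal_nonneg (β r y : ℝ) : 0 ≤ besselKReal β r y :=
  setIntegral_nonneg measurableSet_Ioi fun s hs => by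
    have : (0 : ℝ) < s := hs
    positivity

theorem besselKReal_le_zero {β r y : ℝ} (hr : 0 < r) (hy : 0 ≤ y) (hβ : β < 1) :
    besselKReal β r y ≤ besselKReal β r 0 := by
  refine setIntegral_mono_on (integrableOn_besselKReal hr (Or.inr ⟨hy, hβ⟩))
    (integrableOn_besselKReal hr (Or.inr ⟨le_rfl, hβ⟩)) measurableSet_Ioi fun s hs => ?_
  have h0 : (0 : ℝ) < s := hs
  have : -r * (s + y / s) ≤ -r * (s + 0 / s) := by
    have : 0 ≤ r * (y / s) := by positivity
    rw [zero_div]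
    linarith
  gcongr

theorem hasDerivAt_besselK {β y : ℝ} {q : ℂ} (hq : 0 < q.re) (hy : 0 < y) :
    HasDerivAt (besselK β q) (-q * besselK (β + 1) q y) y := by
  have hs : Ioi (y / 2) ∈ 𝓝 y := Ioi_mem_nhds (by linarith)
  have key := (hasDerivAt_integral_of_dominated_loc_of_deriv_le hs
    (μ := volume.restrict (Ioi (0 : ℝ)))
    (F := fun y s => ((s ^ (-β) : ℝ) : ℂ) * Complex.exp (-q * ((s + y / s : ℝ) : ℂ)))
    (F' := fun y s => -q * (((s ^ (-(β + 1)) : ℝ) : ℂ) * Complex.exp (-q * ((s + y / s : ℝ) : ℂ))))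
    (bound := fun s => ‖q‖ * (s ^ (-(β + 1)) * Real.exp (-q.re * (s + (y / 2) / s)))) ?_
    (integrableOn_besselK hq (Or.inl hy)) ?_ ?_
    ((integrableOn_besselKReal hq (Or.inl (by positivity))).const_mul _) ?_).2
  · rw [integral_const_mul] at key
    exact key
  · exact Eventually.of_forall fun z => aestronglyMeasurable_besselK β q z
  · exact (aestronglyMeasurable_besselK (β + 1) q y).const_mul _
  · refine (ae_restrict_mem measurableSet_Ioi).mono fun s hs z hz => ?_
    have h0 : (0 : ℝ) < s := hs
    have hz' : y / 2 < z := hz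
    rw [norm_mul, norm_neg, norm_besselK_integrand hs]
    have : -q.re * (s + z / s) ≤ -q.re * (s + y / 2 / s) := by
      have : y / 2 / s ≤ z / s := by gcongr
      nlinarith
    gcongr
  · refine (ae_restrict_mem measurableSet_Ioi).mono fun s hs z _ => ?_
    have h0 : (0 : ℝ) < s := hs
    have h1 : HasDerivAt (fun z : ℝ => s + z / s) (1 / s) z :=
      ((hasDerivAt_id z).div_const s).const_add s
    convert! ((h1.ofReal_comp.const_mul (-q)).cexp.const_mul ((s ^ (-β) : ℝ) : ℂ)) using 1
    rw [neg_add, Real.rpow_add h0, Real.rpow_neg_one]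
    push_cast
    ring

theorem tendsto_besselK_integrand_atTop (β : ℝ) {q : ℂ} (hq : 0 < q.re) {y : ℝ} (hy : 0 < y) :
    Tendsto (fun s : ℝ => ((s ^ (-β) : ℝ) : ℂ) * Complex.exp (-q * ((s + y / s : ℝ) : ℂ)))
      atTop (𝓝 0) := by
  rw [tendsto_zero_iff_norm_tendsto_zero]
  refine squeeze_zero' (Eventually.of_forall fun _ => norm_nonneg _) ?_
    (tendsto_rpow_mul_exp_neg_mul_atTop_nhds_zero (-β) q.re hq)
  filter_upwards [eventually_gt_atTop 0] with s hs
  rw [norm_besselK_integrand hs]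
  have : -q.re * (s + y / s) ≤ -q.re * s := by
    have : 0 ≤ q.re * (y / s) := by positivity
    linarith
  gcongr

theorem tendsto_besselK_integrand_nhdsGT (β : ℝ) {q : ℂ} (hq : 0 < q.re) {y : ℝ} (hy : 0 < y) :
    Tendsto (fun s : ℝ => ((s ^ (-β) : ℝ) : ℂ) * Complex.exp (-q * ((s + y / s : ℝ) : ℂ)))
      (𝓝[>] 0) (𝓝 0) := by
  rw [tendsto_zero_iff_norm_tendsto_zero]
  refine squeeze_zero' (Eventually.of_forall fun _ => norm_nonneg _) ?_
    ((tendsto_rpow_mul_exp_neg_mul_atTop_nhds_zero β (q.re * y) (by positivity)).comp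
      tendsto_inv_nhdsGT_zero)
  filter_upwards [self_mem_nhdsWithin] with s hs
  have h0 : (0 : ℝ) < s := hs
  rw [norm_besselK_integrand hs, Function.comp_apply, Real.inv_rpow h0.le, ← Real.rpow_neg h0.le]
  have : -q.re * (s + y / s) ≤ -(q.re * y) * s⁻¹ := by
    have : 0 ≤ q.re * s := by positivity
    rw [div_eq_mul_inv]
    linarith
  gcongr

/-- Integrate the `s`-derivative of `s ^ (-β) exp (-q (s + y / s))` over the half-line; it vanishes
at both ends. Since differentiation in `y` multiplies by `-q` and raises `β`, this is the equation
`y K'' + β K' = q² K`. -/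
theorem mul_besselK_eq (β : ℝ) {q : ℂ} (hq : 0 < q.re) {y : ℝ} (hy : 0 < y) :
    q * besselK β q y = q * y * besselK (β + 2) q y - β * besselK (β + 1) q y := by
  have i0 := integrableOn_besselK (β := β) hq (Or.inl hy)
  have i1 := integrableOn_besselK (β := β + 1) hq (Or.inl hy)
  have i2 := integrableOn_besselK (β := β + 2) hq (Or.inl hy)
  have hv : ∀ s ∈ Ioi (0 : ℝ), HasDerivAt (fun s : ℝ => Complex.exp (-q * ((s + y / s : ℝ) : ℂ)))
      (Complex.exp (-q * ((s + y / s : ℝ) : ℂ)) * (-q * ((1 - y / s ^ 2 : ℝ) : ℂ))) s := by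
    intro s hs
    have h0 : s ≠ 0 := (mem_Ioi.1 hs).ne'
    have h1 : HasDerivAt (fun s : ℝ => s + y / s) (1 - y / s ^ 2) s := by
      have := (hasDerivAt_id s).add ((hasDerivAt_inv h0).const_mul y)
      convert! this using 1
      ring
    exact (h1.ofReal_comp.const_mul (-q)).cexp
  have e1 : ∀ s ∈ Ioi (0 : ℝ), -q * (((s ^ (-β) : ℝ) : ℂ) * Complex.exp (-q * ((s + y / s : ℝ) : ℂ)))
      + q * y * (((s ^ (-(β + 2)) : ℝ) : ℂ) * Complex.exp (-q * ((s + y / s : ℝ) : ℂ)))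
      = ((s ^ (-β) : ℝ) : ℂ) * (Complex.exp (-q * ((s + y / s : ℝ) : ℂ))
        * (-q * ((1 - y / s ^ 2 : ℝ) : ℂ))) := by
    intro s hs
    have h0 : (0 : ℝ) < s := hs
    rw [neg_add, Real.rpow_add h0, Real.rpow_neg h0.le 2, Real.rpow_two]
    push_cast
    ring
  have e2 : ∀ s : ℝ, -β * (((s ^ (-(β + 1)) : ℝ) : ℂ) * Complex.exp (-q * ((s + y / s : ℝ) : ℂ)))
      = ((-β * s ^ (-β - 1) : ℝ) : ℂ) * Complex.exp (-q * ((s + y / s : ℝ) : ℂ)) := by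
    intro s
    rw [neg_add, sub_eq_add_neg]
    push_cast
    ring
  have key := integral_Ioi_mul_deriv_eq_deriv_mul (a := 0) (a' := 0) (b' := 0)
    (fun s hs => hasDerivAt_ofReal_rpow hs (-β)) hv ?_ ?_
    (tendsto_besselK_integrand_nhdsGT β hq hy) (tendsto_besselK_integrand_atTop β hq hy)
  · rw [← setIntegral_congr_fun measurableSet_Ioi e1,
      integral_add (i0.const_mul (-q)) (i2.const_mul (q * y)), integral_const_mul,
      integral_const_mul] at key
    simp only [← e2] at key
    rw [integral_const_mul] at key
    unfold besselK
    linear_combination -key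
  · exact IntegrableOn.congr_fun ((i0.const_mul (-q)).add (i2.const_mul (q * y))) e1
      measurableSet_Ioi
  · exact IntegrableOn.congr_fun (i1.const_mul (-β : ℂ)) (fun s _ => e2 s) measurableSet_Ioi

/-- The symmetry of `besselK` under `s ↦ y / s`. -/
theorem rpow_mul_besselK (β : ℝ) (q : ℂ) {x : ℝ} (hx : 0 < x) :
    ((x ^ β : ℝ) : ℂ) * besselK (β + 1) q x = besselK (1 - β) q x := by
  set K : ℝ → ℂ := fun s => ((s ^ (-(1 - β)) : ℝ) : ℂ) * Complex.exp (-q * ((s + x / s : ℝ) : ℂ))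
  set H : ℝ → ℂ := fun t => ((t ^ (β - 1) : ℝ) : ℂ) * Complex.exp (-q * ((t⁻¹ + x * t : ℝ) : ℂ))
  have h1 : besselK (β + 1) q x = ∫ t : ℝ in Ioi 0, H t := by
    unfold besselK
    -- The substitution is made in two pieces: inversion `s = t⁻¹` here, and the scaling `s = x t`
    -- for `h2`.
    rw [← integral_comp_rpow_Ioi (p := -1) _ (by norm_num)]
    refine setIntegral_congr_fun measurableSet_Ioi fun t ht => ?_
    have h0 : (0 : ℝ) < t := ht
    have : |(-1 : ℝ)| * t ^ ((-1 : ℝ) - 1) * (t⁻¹) ^ (-(β + 1)) = t ^ (β - 1) := by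
      rw [Real.inv_rpow h0.le, ← Real.rpow_neg h0.le, abs_neg, abs_one, one_mul,
        ← Real.rpow_add h0]
      congr 1
      ring
    simp only [Real.rpow_neg_one, H]
    rw [← this, div_inv_eq_mul, Complex.real_smul, Complex.ofReal_mul _ ((t⁻¹) ^ (-(β + 1))),
      mul_assoc]
  have h2 : ∫ t : ℝ in Ioi 0, K (x * t) = ((x ^ (β - 1) : ℝ) : ℂ) * ∫ t : ℝ in Ioi 0, H t := by
    rw [← integral_const_mul]
    refine setIntegral_congr_fun measurableSet_Ioi fun t ht => ?_
    have h0 : (0 : ℝ) < t := ht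
    simp only [K, H]
    rw [neg_sub, Real.mul_rpow hx.le h0.le, show x * t + x / (x * t) = t⁻¹ + x * t by
      field_simp; ring]
    push_cast
    ring
  rw [integral_comp_mul_left_Ioi K 0 hx, mul_zero, ← h1, inv_smul_eq_iff₀ hx.ne'] at h2
  show _ = ∫ s in Ioi 0, K s
  rw [h2, Complex.real_smul, ← mul_assoc, ← Complex.ofReal_mul, Real.rpow_sub_one hx.ne',
    mul_div_cancel₀ _ hx.ne']

theorem tendsto_besselK_zero {β : ℝ} (hβ : β < 1) {q : ℂ} (hq : 0 < q.re) :
    Tendsto (besselK β q) (𝓝[>] 0) (𝓝 (besselK β q 0)) := by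
  refine tendsto_integral_filter_of_dominated_convergence
    (fun s => s ^ (-β) * Real.exp (-q.re * (s + 0 / s))) ?_ ?_
    (integrableOn_besselKReal hq (Or.inr ⟨le_rfl, hβ⟩)) ?_
  · exact Eventually.of_forall fun y => aestronglyMeasurable_besselK β q y
  · filter_upwards [self_mem_nhdsWithin] with y hy
    refine (ae_restrict_mem measurableSet_Ioi).mono fun s hs => ?_
    have h0 : (0 : ℝ) < s := hs
    have h1 : (0 : ℝ) < y := hy
    rw [norm_besselK_integrand hs]
    have : -q.re * (s + y / s) ≤ -q.re * (s + 0 / s) := by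
      have : 0 ≤ q.re * (y / s) := by positivity
      rw [zero_div]
      linarith
    gcongr
  · refine Eventually.of_forall fun s => ?_
    have : Continuous fun y : ℝ =>
        ((s ^ (-β) : ℝ) : ℂ) * Complex.exp (-q * ((s + y / s : ℝ) : ℂ)) := by fun_prop
    exact (this.tendsto 0).mono_left nhdsWithin_le_nhds

theorem besselK_at_zero {β : ℝ} (hβ : β < 1) {q : ℂ} (hq : 0 < q.re) :
    besselK β q 0 = Real.Gamma (1 - β) * q ^ (-(1 - β : ℝ) : ℂ) := by
  rw [← integral_rpow_mul_cexp_neg (by linarith : 0 < 1 - β) hq]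
  unfold besselK
  refine setIntegral_congr_fun measurableSet_Ioi fun s _ => ?_
  simp

/-- Half of the exponent is spent on `s + y / s ≥ 2 √y`, which gives the decay; the other half keeps
the integral convergent, with `y` replaced by `1`. -/
theorem besselKReal_le_exp {β r y : ℝ} (hr : 0 < r) (hy : 1 ≤ y) :
    besselKReal β r y ≤ Real.exp (-r * √y) * besselKReal β (r / 2) 1 := by
  unfold besselKReal
  rw [← integral_const_mul]
  refine setIntegral_mono_on (integrableOn_besselKReal hr (Or.inl (by linarith)))
    ((integrableOn_besselKReal (half_pos hr) (Or.inl one_pos)).const_mul _) measurableSet_Ioi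
    fun s hs => ?_
  have h0 : (0 : ℝ) < s := hs
  have h1 : √y * 2 ≤ s + y / s := by
    rw [← sub_nonneg]
    have : s + y / s - √y * 2 = (s - √y) ^ 2 / s := by
      have := Real.sq_sqrt (by linarith : 0 ≤ y)
      field_simp
      linear_combination -this
    rw [this]
    positivity
  have h2 : 1 / s ≤ y / s := by gcongr
  have h3 : -r * (s + y / s) ≤ -r * √y + -(r / 2) * (s + 1 / s) := by nlinarith
  calc s ^ (-β) * Real.exp (-r * (s + y / s))
      ≤ s ^ (-β) * Real.exp (-r * √y + -(r / 2) * (s + 1 / s)) := by gcongr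
    _ = _ := by rw [Real.exp_add]; ring

theorem tendsto_rpow_mul_besselKReal_atTop (k β : ℝ) {r : ℝ} (hr : 0 < r) :
    Tendsto (fun y => y ^ k * besselKReal β r y) atTop (𝓝 0) := by
  have h1 : Tendsto (fun y : ℝ => (√y) ^ (2 * k) * Real.exp (-r * √y)) atTop (𝓝 0) :=
    (tendsto_rpow_mul_exp_neg_mul_atTop_nhds_zero (2 * k) r hr).comp Real.tendsto_sqrt_atTop
  have h2 := h1.mul_const (besselKReal β (r / 2) 1)
  rw [zero_mul] at h2
  refine squeeze_zero' ?_ ?_ h2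
  · filter_upwards [eventually_ge_atTop 1] with y hy
    have := besselKReal_nonneg β r y
    positivity
  · filter_upwards [eventually_ge_atTop 1] with y hy
    have h3 : (√y) ^ (2 * k) = y ^ k := by
      rw [Real.sqrt_eq_rpow, ← Real.rpow_mul (by linarith)]
      congr 1
      ring
    rw [h3, mul_assoc]
    gcongr
    exact besselKReal_le_exp hr hy

/-! ### The regular solution and the divergence form of the equation -/

/-- The solution of `x u'' + β u' = q² u` that is regular at the origin. -/
noncomputable def regSol (β : ℝ) (q : ℂ) (x : ℝ) : ℂ := besselI β (q ^ 2 * x)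

/-- `regSol` for real parameters. -/
noncomputable def regSolReal (β r x : ℝ) : ℝ := besselI β (r ^ 2 * x)

theorem regSol_ofReal (β r x : ℝ) : regSol β r x = regSolReal β r x := by
  have := besselI_ofReal (𝕜 := ℂ) (β := β) (r ^ 2 * x)
  simp only [Complex.coe_algebraMap] at this
  rw [regSol, regSolReal, ← this]
  push_cast
  rfl

theorem norm_regSol_le {β : ℝ} (hβ : 0 ≤ β) {q : ℂ} (hq : 0 < q.re) {x : ℝ} (hx : 0 ≤ x) :
    ‖regSol β q x‖ ≤ (‖q‖ / q.re) ^ 2 * regSolReal β q.re x :=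
  norm_besselI_sq_mul_le hβ hq hx

theorem regSolReal_nonneg {β : ℝ} (hβ : 0 ≤ β) (r : ℝ) {x : ℝ} (hx : 0 ≤ x) :
    0 ≤ regSolReal β r x :=
  besselI_nonneg hβ (by positivity)

theorem hasDerivAt_regSol {β : ℝ} (hβ : 0 ≤ β) (q : ℂ) (x : ℝ) :
    HasDerivAt (regSol β q) (q ^ 2 * regSol (β + 1) q x) x := by
  have h1 : HasDerivAt (fun x : ℝ => q ^ 2 * (x : ℂ)) (q ^ 2 * 1) x :=
    (HasDerivAt.ofReal_comp (hasDerivAt_id x)).const_mul _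
  convert! (hasDerivAt_besselI hβ (q ^ 2 * (x : ℂ))).comp x h1 using 1
  rw [regSol]
  ring

theorem continuous_regSol {β : ℝ} (hβ : 0 ≤ β) (q : ℂ) : Continuous (regSol β q) :=
  continuous_iff_continuousAt.2 fun x => (hasDerivAt_regSol hβ q x).continuousAt

theorem continuous_regSolReal {β : ℝ} (hβ : 0 ≤ β) (r : ℝ) : Continuous (regSolReal β r) :=
  (continuous_besselI hβ).comp (continuous_const.mul continuous_id)

theorem regSol_eq {β : ℝ} (hβ : 0 ≤ β) (q : ℂ) (x : ℝ) :
    regSol β q x = q ^ 2 * x * regSol (β + 2) q x + β * regSol (β + 1) q x :=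
  besselI_eq hβ (q ^ 2 * (x : ℂ))

theorem regSol_zero (β : ℝ) (q : ℂ) : regSol β q 0 = coeff β 0 := by
  have := besselI_zero (𝕜 := ℂ) β
  simpa [regSol] using this

theorem regSolReal_zero (β r : ℝ) : regSolReal β r 0 = coeff β 0 := by
  have := besselI_zero (𝕜 := ℝ) β
  simpa [regSolReal] using this

/-- This is the equation in divergence form, `(x ^ β u')' = x ^ (β - 1) q² u`, with `u' = q² regSol
(β + 1)`. It supplies an explicit primitive for the lower Green density;
`hasDerivAt_rpow_mul_besselK` does the same for the upper one. -/
theorem hasDerivAt_rpow_mul_regSol {β : ℝ} (hβ : 0 ≤ β) (q : ℂ) {x : ℝ} (hx : 0 < x) :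
    HasDerivAt (fun y : ℝ => ((y ^ β : ℝ) : ℂ) * regSol (β + 1) q y)
      (((x ^ (β - 1) : ℝ) : ℂ) * regSol β q x) x := by
  convert! (hasDerivAt_ofReal_rpow hx β).mul (hasDerivAt_regSol (by linarith : 0 ≤ β + 1) q x)
    using 1
  rw [regSol_eq hβ, Real.rpow_sub_one hx.ne', show β + 1 + 1 = β + 2 by ring]
  have : (x : ℂ) ≠ 0 := by exact_mod_cast hx.ne'
  push_cast
  field_simp
  ring

theorem hasDerivAt_rpow_mul_besselK (β : ℝ) {q : ℂ} (hq : 0 < q.re) {x : ℝ} (hx : 0 < x) :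
    HasDerivAt (fun y : ℝ => ((y ^ β : ℝ) : ℂ) * besselK (β + 1) q y)
      (-q * (((x ^ (β - 1) : ℝ) : ℂ) * besselK β q x)) x := by
  convert! (hasDerivAt_ofReal_rpow hx β).mul (hasDerivAt_besselK (β := β + 1) hq hx) using 1
  have h := mul_besselK_eq β hq hx
  rw [Real.rpow_sub_one hx.ne', show β + 1 + 1 = β + 2 by ring]
  have : (x : ℂ) ≠ 0 := by exact_mod_cast hx.ne'
  push_cast
  field_simp
  linear_combination -((x ^ β : ℝ) : ℂ) * h

theorem _root_.HasDerivAt.of_complex_ofReal {f : ℝ → ℝ} {f' x : ℝ}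
    (h : HasDerivAt (fun y => (f y : ℂ)) (f' : ℂ) x) : HasDerivAt f f' x := by
  simpa using! (Complex.reCLM.hasFDerivAt.comp_hasDerivAt x h)

theorem hasDerivAt_rpow_mul_regSolReal {β : ℝ} (hβ : 0 ≤ β) (r : ℝ) {x : ℝ} (hx : 0 < x) :
    HasDerivAt (fun y : ℝ => y ^ β * regSolReal (β + 1) r y)
      (x ^ (β - 1) * regSolReal β r x) x := by
  apply HasDerivAt.of_complex_ofReal
  have := hasDerivAt_rpow_mul_regSol hβ r hx
  simp only [regSol_ofReal] at this
  exact_mod_cast this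

theorem hasDerivAt_rpow_mul_besselKReal (β : ℝ) {r : ℝ} (hr : 0 < r) {x : ℝ} (hx : 0 < x) :
    HasDerivAt (fun y : ℝ => y ^ β * besselKReal (β + 1) r y)
      (-r * (x ^ (β - 1) * besselKReal β r x)) x := by
  apply HasDerivAt.of_complex_ofReal
  have := hasDerivAt_rpow_mul_besselK β (q := r) (by simpa) hx
  simp only [besselK_ofReal] at this
  exact_mod_cast this

/-! ### The Wronskian -/

/-- The Wronskian of `besselK` and `regSol`, multiplied by `x ^ β`. -/
noncomputable def wronsk (β : ℝ) (q : ℂ) (x : ℝ) : ℂ :=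
  ((x ^ β : ℝ) : ℂ) * (q ^ 2 * regSol (β + 1) q x * besselK β q x
    + q * regSol β q x * besselK (β + 1) q x)

/-- Applying each recurrence once exchanges the two products. Raising the parameter moves the
evaluation of the constant to `β > 1`, where the limit at the origin is elementary. -/
theorem wronsk_eq_mul {β : ℝ} (hβ : 0 ≤ β) {q : ℂ} (hq : 0 < q.re) {x : ℝ} (hx : 0 < x) :
    wronsk β q x = q * wronsk (β + 1) q x := by
  have h1 := mul_besselK_eq β hq hx
  have h2 := regSol_eq hβ q x
  unfold wronsk
  rw [h2, Real.rpow_add_one hx.ne', show β + 1 + 1 = β + 2 by ring]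
  push_cast
  linear_combination ((x ^ β : ℝ) : ℂ) * q * regSol (β + 1) q x * h1

theorem hasDerivAt_wronsk {β : ℝ} (hβ : 0 ≤ β) {q : ℂ} (hq : 0 < q.re) {x : ℝ} (hx : 0 < x) :
    HasDerivAt (wronsk β q) 0 x := by
  have h := (((hasDerivAt_rpow_mul_regSol hβ q hx).mul (hasDerivAt_besselK (β := β) hq hx)).const_mul
    (q ^ 2)).add (((hasDerivAt_rpow_mul_besselK β hq hx).mul (hasDerivAt_regSol hβ q x)).const_mul q)
  convert! h using 1
  · ext y
    simp only [wronsk, Pi.add_apply, Pi.mul_apply]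
    ring
  · ring

theorem eq_of_hasDerivAt_zero {f : ℝ → ℂ} (hf : ∀ x, 0 < x → HasDerivAt f 0 x) {x y : ℝ}
    (hx : 0 < x) (hy : 0 < y) : f x = f y :=
  isOpen_Ioi.is_const_of_deriv_eq_zero (convex_Ioi 0).isPreconnected
    (fun z hz => (hf z hz).differentiableAt.differentiableWithinAt) (fun z hz => (hf z hz).deriv)
    hx hy

theorem eq_of_hasDerivAt_zero_of_tendsto {f : ℝ → ℂ} (hf : ∀ x, 0 < x → HasDerivAt f 0 x) {l : ℂ}
    {F : Filter ℝ} [F.NeBot] (hF : ∀ᶠ x in F, 0 < x) (h : Tendsto f F (𝓝 l)) {x : ℝ} (hx : 0 < x) :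
    f x = l := by
  refine tendsto_nhds_unique (tendsto_const_nhds.congr' ?_) h
  filter_upwards [hF] with y hy using eq_of_hasDerivAt_zero hf hx hy

/-- By reflection `x ^ β K_{β+1} = K_{1-β}` and `x ^ β K_β = x K_{2-β}`, and both right-hand `K`'s
are finite at the origin when `β > 1`. The second product then vanishes in the limit, and the first
gives `Γ(β) q ^ (-β)`, whose Gamma factor cancels `coeff β 0`. -/
theorem tendsto_wronsk {β : ℝ} (hβ : 1 < β) {q : ℂ} (hq : 0 < q.re) :
    Tendsto (wronsk β q) (𝓝[>] 0) (𝓝 (q * q ^ (-β : ℂ))) := by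
  have t1 : ∀ β, 0 ≤ β → Tendsto (regSol β q) (𝓝[>] 0) (𝓝 (coeff β 0)) := by
    intro β hβ
    rw [← regSol_zero β q]
    exact ((continuous_regSol hβ q).tendsto 0).mono_left nhdsWithin_le_nhds
  have t2 := tendsto_besselK_zero (β := 1 - β) (by linarith) hq
  have t3 := tendsto_besselK_zero (β := 1 - (β - 1)) (by linarith) hq
  have t4 : Tendsto (fun x : ℝ => (x : ℂ)) (𝓝[>] 0) (𝓝 0) :=
    (Complex.continuous_ofReal.tendsto 0).mono_left nhdsWithin_le_nhds
  have h := (((t1 (β + 1) (by linarith)).const_mul (q ^ 2)).mul (t4.mul t3)).add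
    (((t1 β (by linarith)).const_mul q).mul t2)
  rw [besselK_at_zero (by linarith : 1 - β < 1) hq] at h
  have hG : (Real.Gamma β : ℂ) ≠ 0 := by
    exact_mod_cast (Real.Gamma_pos_of_pos (by linarith)).ne'
  convert! h.congr' ?_ using 2
  · simp only [coeff, sub_sub_cancel, Nat.factorial_zero, Nat.cast_one, Nat.cast_zero, zero_add,
      one_mul, zero_mul, mul_zero]
    push_cast
    field_simp
  · filter_upwards [self_mem_nhdsWithin] with x hx
    have hx' : (0 : ℝ) < x := hx
    rw [← rpow_mul_besselK β q hx', ← rpow_mul_besselK (β - 1) q hx', wronsk,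
      Real.rpow_sub_one hx'.ne', sub_add_cancel]
    have : (x : ℂ) ≠ 0 := by exact_mod_cast hx'.ne'
    push_cast
    field_simp

theorem ne_zero_of_re_pos {q : ℂ} (hq : 0 < q.re) : q ≠ 0 := by
  rintro rfl
  simp at hq

theorem wronsk_eq {β : ℝ} (hβ : 0 ≤ β) {q : ℂ} (hq : 0 < q.re) {x : ℝ} (hx : 0 < x) :
    wronsk β q x = q ^ (1 - β : ℂ) := by
  -- Two raises are needed: for `β = 0` a single one reaches only `1`, while the limit requires a
  -- parameter above `1`.
  rw [wronsk_eq_mul hβ hq hx, wronsk_eq_mul (by linarith) hq hx,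
    eq_of_hasDerivAt_zero_of_tendsto (F := 𝓝[>] 0) (fun y hy => hasDerivAt_wronsk (by linarith) hq hy)
      self_mem_nhdsWithin (tendsto_wronsk (by linarith : 1 < β + 1 + 1) hq) hx]
  have h0 := ne_zero_of_re_pos hq
  have : (1 - β : ℂ) = 1 + 1 + 1 + -((β + 1 + 1 : ℝ) : ℂ) := by
    push_cast
    ring
  rw [this, Complex.cpow_add _ _ h0, Complex.cpow_add _ _ h0, Complex.cpow_add _ _ h0,
    Complex.cpow_one]
  ring

theorem wronsk_real {β : ℝ} (hβ : 0 ≤ β) {r : ℝ} (hr : 0 < r) {x : ℝ} (hx : 0 < x) :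
    x ^ β * (r ^ 2 * regSolReal (β + 1) r x * besselKReal β r x
      + r * regSolReal β r x * besselKReal (β + 1) r x) = r ^ (1 - β) := by
  have h := wronsk_eq hβ (q := r) (by simpa) hx
  rw [wronsk, regSol_ofReal, regSol_ofReal, besselK_ofReal, besselK_ofReal, ← Complex.ofReal_one,
    ← Complex.ofReal_sub, ← Complex.ofReal_cpow hr.le] at h
  exact_mod_cast h

/-! ### Integrals of the real densities -/

section Integrals

theorem continuous_rpow_mul_regSolReal {β : ℝ} (hβ : 0 ≤ β) (r : ℝ) :
    Continuous (fun y : ℝ => y ^ β * regSolReal (β + 1) r y) :=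
  (Real.continuous_rpow_const hβ).mul (continuous_regSolReal (by linarith) r)

/-- A nonnegative derivative of a function continuous up to the endpoint is integrable, which
handles the singular factor `y ^ (β - 1)` at the origin, including `β = 0`. -/
theorem intervalIntegrable_regSolReal {β : ℝ} (hβ : 0 ≤ β) (r : ℝ) {a b : ℝ} (ha : 0 ≤ a)
    (hab : a ≤ b) :
    IntervalIntegrable (fun y => y ^ (β - 1) * regSolReal β r y) volume a b := by
  refine intervalIntegral.intervalIntegrable_deriv_of_nonneg
    (continuous_rpow_mul_regSolReal hβ r).continuousOn ?_ ?_
  all_goals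
    intro x hx
    rw [min_eq_left hab, max_eq_right hab] at hx
    have hx0 : 0 < x := ha.trans_lt hx.1
  · exact hasDerivAt_rpow_mul_regSolReal hβ r hx0
  · exact mul_nonneg (by positivity) (regSolReal_nonneg hβ r hx0.le)

theorem integral_regSolReal {β : ℝ} (hβ : 0 ≤ β) (r : ℝ) {a b : ℝ} (ha : 0 ≤ a) (hab : a ≤ b) :
    ∫ y in a..b, y ^ (β - 1) * regSolReal β r y
      = b ^ β * regSolReal (β + 1) r b - a ^ β * regSolReal (β + 1) r a :=
  intervalIntegral.integral_eq_sub_of_hasDerivAt_of_le hab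
    (continuous_rpow_mul_regSolReal hβ r).continuousOn
    (fun _ hx => hasDerivAt_rpow_mul_regSolReal hβ r (ha.trans_lt hx.1))
    (intervalIntegrable_regSolReal hβ r ha hab)

theorem integrableOn_besselKReal_Ioi (β : ℝ) {r : ℝ} (hr : 0 < r) {a : ℝ} (ha : 0 < a) :
    IntegrableOn (fun y => y ^ (β - 1) * besselKReal β r y) (Ioi a) := by
  have h : IntegrableOn (fun y => -r * (y ^ (β - 1) * besselKReal β r y)) (Ioi a) := by
    refine integrableOn_Ioi_deriv_of_nonpos' (l := 0)
      (fun x hx => hasDerivAt_rpow_mul_besselKReal β hr (ha.trans_le hx)) ?_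
      (tendsto_rpow_mul_besselKReal_atTop β (β + 1) hr)
    intro x hx
    have h0 : 0 < x := ha.trans hx
    have : 0 ≤ r * (x ^ (β - 1) * besselKReal β r x) :=
      mul_nonneg hr.le (mul_nonneg (by positivity) (besselKReal_nonneg _ _ _))
    linarith
  refine IntegrableOn.congr_fun (Integrable.const_mul h (-r⁻¹)) (fun y _ => ?_) measurableSet_Ioi
  field_simp

theorem integral_besselKReal_Ioi (β : ℝ) {r : ℝ} (hr : 0 < r) {a : ℝ} (ha : 0 < a) :
    ∫ y in Ioi a, y ^ (β - 1) * besselKReal β r y = a ^ β * besselKReal (β + 1) r a / r := by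
  have h := integral_Ioi_of_hasDerivAt_of_tendsto' (m := 0)
    (fun x hx => hasDerivAt_rpow_mul_besselKReal β hr (ha.trans_le hx))
    (Integrable.const_mul (integrableOn_besselKReal_Ioi β hr ha) (-r))
    (tendsto_rpow_mul_besselKReal_atTop β (β + 1) hr)
  rw [integral_const_mul] at h
  rw [eq_div_iff hr.ne']
  linarith

end Integrals

/-! ### The Green operator: equation, uniform bound and limits -/

section Green

/-- The density of the Green operator below the diagonal. -/
noncomputable def lowerDensity (β : ℝ) (q : ℂ) (g : ℝ → ℂ) (y : ℝ) : ℂ :=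
  ((y ^ (β - 1) : ℝ) : ℂ) * regSol β q y * g y

/-- The density of the Green operator above the diagonal. -/
noncomputable def upperDensity (β : ℝ) (q : ℂ) (g : ℝ → ℂ) (y : ℝ) : ℂ :=
  ((y ^ (β - 1) : ℝ) : ℂ) * besselK β q y * g y

/-- The Green operator of `q² - x D² - β D`. -/
noncomputable def green (β : ℝ) (q : ℂ) (g : ℝ → ℂ) (x : ℝ) : ℂ :=
  (besselK β q x * (∫ y in 0..x, lowerDensity β q g y)
    + regSol β q x * ∫ y in Ioi x, upperDensity β q g y) / q ^ (1 - β : ℂ)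

/-- The derivative of `green`. -/
noncomputable def greenDeriv (β : ℝ) (q : ℂ) (g : ℝ → ℂ) (x : ℝ) : ℂ :=
  (-q * besselK (β + 1) q x * (∫ y in 0..x, lowerDensity β q g y)
    + q ^ 2 * regSol (β + 1) q x * ∫ y in Ioi x, upperDensity β q g y) / q ^ (1 - β : ℂ)

variable {β : ℝ} {q : ℂ} {g : ℝ → ℂ} {M : ℝ}

theorem continuousOn_ofReal_rpow (a : ℝ) :
    ContinuousOn (fun y : ℝ => ((y ^ a : ℝ) : ℂ)) (Ioi 0) := fun _ hx =>
  (hasDerivAt_ofReal_rpow hx a).continuousAt.continuousWithinAt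

theorem continuousOn_lowerDensity (hβ : 0 ≤ β) (hg : ContinuousOn g (Ioi 0)) :
    ContinuousOn (lowerDensity β q g) (Ioi 0) :=
  ((continuousOn_ofReal_rpow _).mul (continuous_regSol hβ q).continuousOn).mul hg

theorem continuousOn_upperDensity (hq : 0 < q.re) (hg : ContinuousOn g (Ioi 0)) :
    ContinuousOn (upperDensity β q g) (Ioi 0) :=
  ((continuousOn_ofReal_rpow _).mul fun _ hx =>
    (hasDerivAt_besselK hq hx).continuousAt.continuousWithinAt).mul hg

theorem norm_lowerDensity_le (hβ : 0 ≤ β) (hq : 0 < q.re) {y : ℝ} (hy : 0 < y) (h : ‖g y‖ ≤ M) :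
    ‖lowerDensity β q g y‖
      ≤ (‖q‖ / q.re) ^ 2 * M * (y ^ (β - 1) * regSolReal β q.re y) := by
  have h1 := norm_regSol_le hβ hq hy.le
  have h2 := regSolReal_nonneg hβ q.re hy.le
  rw [lowerDensity, norm_mul, norm_mul, Complex.norm_real, Real.norm_of_nonneg (by positivity)]
  calc y ^ (β - 1) * ‖regSol β q y‖ * ‖g y‖
      ≤ y ^ (β - 1) * ((‖q‖ / q.re) ^ 2 * regSolReal β q.re y) * M := by gcongr
    _ = _ := by ring

theorem norm_upperDensity_le (hq : 0 < q.re) {y : ℝ} (hy : 0 < y) (h : ‖g y‖ ≤ M) :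
    ‖upperDensity β q g y‖ ≤ M * (y ^ (β - 1) * besselKReal β q.re y) := by
  have h1 := norm_besselK_le (β := β) hq (Or.inl hy)
  have h2 := besselKReal_nonneg β q.re y
  rw [upperDensity, norm_mul, norm_mul, Complex.norm_real, Real.norm_of_nonneg (by positivity)]
  calc y ^ (β - 1) * ‖besselK β q y‖ * ‖g y‖
      ≤ y ^ (β - 1) * besselKReal β q.re y * M := by gcongr
    _ = _ := by ring

theorem intervalIntegrable_lowerDensity (hβ : 0 ≤ β) (hq : 0 < q.re) (hg : ContinuousOn g (Ioi 0))
    {a b : ℝ} (ha : 0 ≤ a) (hab : a ≤ b) (hM : ∀ y, 0 < y → ‖g y‖ ≤ M) :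
    IntervalIntegrable (lowerDensity β q g) volume a b := by
  rw [intervalIntegrable_iff_integrableOn_Ioc_of_le hab]
  have h := (intervalIntegrable_iff_integrableOn_Ioc_of_le hab).1
    (intervalIntegrable_regSolReal hβ q.re ha hab)
  refine Integrable.mono' (h.const_mul ((‖q‖ / q.re) ^ 2 * M)) ?_ ?_
  · exact ((continuousOn_lowerDensity hβ hg).mono fun y hy => ha.trans_lt hy.1).aestronglyMeasurable
      measurableSet_Ioc
  · refine (ae_restrict_mem measurableSet_Ioc).mono fun y hy => ?_
    have h0 : 0 < y := ha.trans_lt hy.1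
    exact norm_lowerDensity_le hβ hq h0 (hM y h0)

theorem norm_integral_lowerDensity_le (hβ : 0 ≤ β) (hq : 0 < q.re)
    {a b : ℝ} (ha : 0 ≤ a) (hab : a ≤ b) (hM : ∀ y, a < y → ‖g y‖ ≤ M) :
    ‖∫ y in a..b, lowerDensity β q g y‖ ≤ (‖q‖ / q.re) ^ 2 * M *
      (b ^ β * regSolReal (β + 1) q.re b - a ^ β * regSolReal (β + 1) q.re a) := by
  rw [← integral_regSolReal hβ q.re ha hab, ← intervalIntegral.integral_const_mul]
  refine intervalIntegral.norm_integral_le_of_norm_le hab (Eventually.of_forall fun y hy => ?_)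
    ((intervalIntegrable_regSolReal hβ q.re ha hab).const_mul _)
  exact norm_lowerDensity_le hβ hq (ha.trans_lt hy.1) (hM y hy.1)

theorem integrableOn_upperDensity (hq : 0 < q.re) (hg : ContinuousOn g (Ioi 0))
    {a : ℝ} (ha : 0 < a) (hM : ∀ y, 0 < y → ‖g y‖ ≤ M) :
    IntegrableOn (upperDensity β q g) (Ioi a) := by
  refine Integrable.mono' ((integrableOn_besselKReal_Ioi β hq ha).const_mul M) ?_ ?_
  · exact ((continuousOn_upperDensity hq hg).mono (Ioi_subset_Ioi ha.le)).aestronglyMeasurable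
      measurableSet_Ioi
  · refine (ae_restrict_mem measurableSet_Ioi).mono fun y hy => ?_
    have h0 : 0 < y := ha.trans hy
    exact norm_upperDensity_le hq h0 (hM y h0)

theorem norm_integral_upperDensity_le (hq : 0 < q.re) {a : ℝ} (ha : 0 < a)
    (hM : ∀ y, a < y → ‖g y‖ ≤ M) :
    ‖∫ y in Ioi a, upperDensity β q g y‖ ≤ M * (a ^ β * besselKReal (β + 1) q.re a / q.re) := by
  rw [← integral_besselKReal_Ioi β hq ha, ← integral_const_mul]
  refine norm_integral_le_of_norm_le ((integrableOn_besselKReal_Ioi β hq ha).const_mul M) ?_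
  refine (ae_restrict_mem measurableSet_Ioi).mono fun y hy => ?_
  exact norm_upperDensity_le hq (ha.trans hy) (hM y hy)

theorem hasDerivAt_integral_lowerDensity (hβ : 0 ≤ β) (hq : 0 < q.re)
    (hg : ContinuousOn g (Ioi 0)) (hM : ∀ y, 0 < y → ‖g y‖ ≤ M) {x : ℝ} (hx : 0 < x) :
    HasDerivAt (fun x => ∫ y in 0..x, lowerDensity β q g y) (lowerDensity β q g x) x :=
  intervalIntegral.integral_hasDerivAt_right
    (intervalIntegrable_lowerDensity hβ hq hg le_rfl hx.le hM)
    ((continuousOn_lowerDensity hβ hg).stronglyMeasurableAtFilter isOpen_Ioi x hx)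
    ((continuousOn_lowerDensity hβ hg).continuousAt (Ioi_mem_nhds hx))

theorem hasDerivAt_integral_upperDensity (hq : 0 < q.re)
    (hg : ContinuousOn g (Ioi 0)) (hM : ∀ y, 0 < y → ‖g y‖ ≤ M) {x : ℝ} (hx : 0 < x) :
    HasDerivAt (fun x => ∫ y in Ioi x, upperDensity β q g y) (-upperDensity β q g x) x := by
  -- The base point `x / 2` is used because the upper density need not be integrable down to the
  -- origin.
  have hx2 : 0 < x / 2 := by positivity
  have hint := integrableOn_upperDensity (β := β) hq hg hx2 hM
  have h1 : HasDerivAt (fun z => ∫ y in (x / 2)..z, upperDensity β q g y)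
      (upperDensity β q g x) x := by
    refine intervalIntegral.integral_hasDerivAt_right ?_
      ((continuousOn_upperDensity hq hg).stronglyMeasurableAtFilter isOpen_Ioi x hx)
      ((continuousOn_upperDensity hq hg).continuousAt (Ioi_mem_nhds hx))
    rw [intervalIntegrable_iff_integrableOn_Ioc_of_le (by linarith)]
    exact hint.mono_set Ioc_subset_Ioi_self
  refine (h1.const_sub (∫ y in Ioi (x / 2), upperDensity β q g y)).congr_of_eventuallyEq ?_
  filter_upwards [Ioi_mem_nhds (by linarith : x / 2 < x)] with z hz
  rw [← intervalIntegral.integral_Ioi_sub_Ioi hint (le_of_lt hz)]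
  ring

/-- In variation of parameters the two terms from differentiating the limits of integration are
opposite at first order. At second order, in `hasDerivAt_greenDeriv`, they combine into the
Wronskian and produce `-g x / x`. -/
theorem hasDerivAt_green (hβ : 0 ≤ β) (hq : 0 < q.re) (hg : ContinuousOn g (Ioi 0))
    (hM : ∀ y, 0 < y → ‖g y‖ ≤ M) {x : ℝ} (hx : 0 < x) :
    HasDerivAt (green β q g) (greenDeriv β q g x) x := by
  have h1 := hasDerivAt_integral_lowerDensity hβ hq hg hM hx
  have h2 := hasDerivAt_integral_upperDensity (β := β) hq hg hM hx
  have h := (((hasDerivAt_besselK (β := β) hq hx).mul h1).add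
    ((hasDerivAt_regSol hβ q x).mul h2)).div_const (q ^ (1 - β : ℂ))
  convert! h using 1
  rw [greenDeriv, lowerDensity, upperDensity]
  ring

theorem hasDerivAt_greenDeriv (hβ : 0 ≤ β) (hq : 0 < q.re) (hg : ContinuousOn g (Ioi 0))
    (hM : ∀ y, 0 < y → ‖g y‖ ≤ M) {x : ℝ} (hx : 0 < x) :
    HasDerivAt (greenDeriv β q g)
      ((q ^ 2 * green β q g x - β * greenDeriv β q g x - g x) / x) x := by
  have h1 := hasDerivAt_integral_lowerDensity hβ hq hg hM hx
  have h2 := hasDerivAt_integral_upperDensity (β := β) hq hg hM hx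
  have h := ((((hasDerivAt_besselK (β := β + 1) hq hx).const_mul (-q)).mul h1).add
    (((hasDerivAt_regSol (by linarith : 0 ≤ β + 1) q x).const_mul (q ^ 2)).mul h2)).div_const
      (q ^ (1 - β : ℂ))
  convert! h using 1
  have hw := wronsk_eq hβ hq hx
  have hx0 : (x : ℂ) ≠ 0 := by exact_mod_cast hx.ne'
  have hw0 : q ^ (1 - β : ℂ) ≠ 0 := by simp [Complex.cpow_eq_zero_iff, ne_zero_of_re_pos hq]
  have e1 := mul_besselK_eq β hq hx
  have e2 := regSol_eq hβ q x
  rw [green, greenDeriv, lowerDensity, upperDensity, Real.rpow_sub_one hx.ne']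
  rw [wronsk] at hw
  rw [show β + 1 + 1 = β + 2 by ring]
  generalize (∫ y in 0..x, lowerDensity β q g y) = P
  generalize (∫ y in Ioi x, upperDensity β q g y) = Q
  push_cast
  field_simp
  linear_combination q * P * e1 + q ^ 2 * Q * e2 + g x * hw

/-- Uniform bound for the Green operator, with the defect at the origin kept when `β = 0`. -/
theorem norm_green_le_sub (hβ : 0 ≤ β) (hq : 0 < q.re) (hM : ∀ y, 0 < y → ‖g y‖ ≤ M)
    {x : ℝ} (hx : 0 < x) :
    ‖green β q g x‖ ≤ (‖q‖ / q.re) ^ 2 * M * (q.re ^ (1 - β) / q.re ^ 2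
      - (0 : ℝ) ^ β * regSolReal (β + 1) q.re 0 * besselKReal β q.re x) / ‖q‖ ^ (1 - β) := by
  have hM0 : 0 ≤ M := (norm_nonneg _).trans (hM x hx)
  have hqn : 0 < ‖q‖ := norm_pos_iff.2 (ne_zero_of_re_pos hq)
  have h1 : 1 ≤ (‖q‖ / q.re) ^ 2 := one_le_pow₀ (by
    rw [one_le_div hq]
    exact (le_abs_self _).trans (Complex.abs_re_le_norm q))
  have p1 := norm_integral_lowerDensity_le hβ hq le_rfl hx.le hM
  have p2 := norm_integral_upperDensity_le (β := β) hq hx fun y hy => hM y (hx.trans hy)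
  have k1 := norm_besselK_le (β := β) hq (Or.inl hx)
  have k2 := norm_regSol_le hβ hq hx.le
  have n1 := besselKReal_nonneg β q.re x
  have n2 := regSolReal_nonneg hβ q.re hx.le
  have n3 := besselKReal_nonneg (β + 1) q.re x
  have hw := wronsk_real hβ hq hx
  have hc : ‖q ^ (1 - β : ℂ)‖ = ‖q‖ ^ (1 - β) := by
    rw [← Complex.norm_cpow_real]
    push_cast
    rfl
  rw [green, norm_div, hc]
  gcongr
  refine (norm_add_le _ _).trans ?_
  rw [norm_mul, norm_mul]
  calc _ ≤ besselKReal β q.re x * ((‖q‖ / q.re) ^ 2 * M *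
          (x ^ β * regSolReal (β + 1) q.re x - 0 ^ β * regSolReal (β + 1) q.re 0))
        + ((‖q‖ / q.re) ^ 2 * regSolReal β q.re x)
          * (M * (x ^ β * besselKReal (β + 1) q.re x / q.re)) := by gcongr
    _ = _ := by
      -- The bracket is the real Wronskian divided by `(Re q)²`, less the boundary term at the
      -- origin. There `0 ^ β` is `1` for `β = 0` and `0` otherwise.
      rw [← hw]
      field_simp
      ring

theorem norm_green_le (hβ : 0 ≤ β) (hq : 0 < q.re) (hM : ∀ y, 0 < y → ‖g y‖ ≤ M)
    {x : ℝ} (hx : 0 < x) :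
    ‖green β q g x‖ ≤ (‖q‖ / q.re) ^ 2 * M * (q.re ^ (1 - β) / q.re ^ 2) / ‖q‖ ^ (1 - β) := by
  refine (norm_green_le_sub hβ hq hM hx).trans ?_
  have hM0 : 0 ≤ M := (norm_nonneg _).trans (hM x hx)
  have n1 := besselKReal_nonneg β q.re x
  have n2 := regSolReal_nonneg (by linarith : 0 ≤ β + 1) q.re (le_refl (0 : ℝ))
  have : 0 ≤ (0 : ℝ) ^ β * regSolReal (β + 1) q.re 0 * besselKReal β q.re x := by positivity
  gcongr
  linarith

theorem tendsto_besselK_atTop (β : ℝ) (hq : 0 < q.re) :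
    Tendsto (besselK β q) atTop (𝓝 0) := by
  have h := tendsto_rpow_mul_besselKReal_atTop 0 β hq
  simp only [Real.rpow_zero, one_mul] at h
  refine squeeze_zero_norm' ?_ h
  filter_upwards [eventually_gt_atTop 0] with x hx using norm_besselK_le hq (Or.inl hx)

/-- Cut the lower integral at a point `N` beyond which `g` is at most `δ`. The part up to `N` is a
constant times the decaying `besselK`; the rest obeys the uniform bound with `δ` as the supremum,
and `δ` is chosen to make it `ε / 2`. -/
theorem tendsto_green_atTop (hβ : 0 ≤ β) (hq : 0 < q.re) (hg : ContinuousOn g (Ioi 0))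
    (hM : ∀ y, 0 < y → ‖g y‖ ≤ M) (h0 : Tendsto g atTop (𝓝 0)) :
    Tendsto (green β q g) atTop (𝓝 0) := by
  have hqn : 0 < ‖q‖ := norm_pos_iff.2 (ne_zero_of_re_pos hq)
  have hc : ‖q ^ (1 - β : ℂ)‖ = ‖q‖ ^ (1 - β) := by
    rw [← Complex.norm_cpow_real]
    push_cast
    rfl
  set D : ℝ := (‖q‖ / q.re) ^ 2 * (q.re ^ (1 - β) / q.re ^ 2) / ‖q‖ ^ (1 - β) with hD
  have hDpos : 0 < D := by positivity
  rw [Metric.tendsto_nhds]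
  intro ε hε
  set δ := ε / (2 * D) with hδ
  have hδpos : 0 < δ := by positivity
  obtain ⟨N, hN⟩ := (((Metric.tendsto_nhds.1 h0) δ hδpos).and (eventually_gt_atTop 0)).exists_forall_of_atTop
  have hN0 : 0 < N := (hN N le_rfl).2
  have hgN : ∀ y, N < y → ‖g y‖ ≤ δ := fun y hy => by
    have := (hN y hy.le).1.le
    rwa [dist_zero_right] at this
  set I := ∫ y in 0..N, lowerDensity β q g y with hI
  have hK : Tendsto (fun x => ‖besselK β q x * I / q ^ (1 - β : ℂ)‖) atTop (𝓝 0) := by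
    have := (((tendsto_besselK_atTop β hq).mul_const I).div_const (q ^ (1 - β : ℂ))).norm
    simpa using this
  filter_upwards [(Metric.tendsto_nhds.1 hK) (ε / 2) (by positivity), eventually_gt_atTop N]
    with x hx hNx
  have hx0 : 0 < x := hN0.trans hNx
  rw [dist_zero_right, norm_norm] at hx
  rw [dist_zero_right]
  have hsplit : green β q g x = besselK β q x * I / q ^ (1 - β : ℂ)
      + (besselK β q x * (∫ y in N..x, lowerDensity β q g y)
        + regSol β q x * ∫ y in Ioi x, upperDensity β q g y) / q ^ (1 - β : ℂ) := by
    rw [green, ← intervalIntegral.integral_add_adjacent_intervals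
      (intervalIntegrable_lowerDensity hβ hq hg le_rfl hN0.le hM)
      (intervalIntegrable_lowerDensity hβ hq hg hN0.le hNx.le hM)]
    ring
  have p1 := norm_integral_lowerDensity_le hβ hq hN0.le hNx.le hgN
  have p2 := norm_integral_upperDensity_le (β := β) hq hx0 fun y hy => hgN y (hNx.trans hy)
  have k1 := norm_besselK_le (β := β) hq (Or.inl hx0)
  have k2 := norm_regSol_le hβ hq hx0.le
  have n1 := besselKReal_nonneg β q.re x
  have n2 := regSolReal_nonneg hβ q.re hx0.le
  have n3 := besselKReal_nonneg (β + 1) q.re x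
  have n4 := regSolReal_nonneg (by linarith : 0 ≤ β + 1) q.re hN0.le
  have n5 : 0 ≤ N ^ β * regSolReal (β + 1) q.re N := by positivity
  have hw := wronsk_real hβ hq hx0
  have h2 : ‖(besselK β q x * (∫ y in N..x, lowerDensity β q g y)
        + regSol β q x * ∫ y in Ioi x, upperDensity β q g y) / q ^ (1 - β : ℂ)‖ ≤ D * δ := by
    rw [norm_div, hc, hD, div_mul_eq_mul_div]
    gcongr
    refine (norm_add_le _ _).trans ?_
    rw [norm_mul, norm_mul]
    calc _ ≤ besselKReal β q.re x * ((‖q‖ / q.re) ^ 2 * δ *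
            (x ^ β * regSolReal (β + 1) q.re x - N ^ β * regSolReal (β + 1) q.re N))
          + ((‖q‖ / q.re) ^ 2 * regSolReal β q.re x)
            * (δ * (x ^ β * besselKReal (β + 1) q.re x / q.re)) := by gcongr
      _ ≤ besselKReal β q.re x * ((‖q‖ / q.re) ^ 2 * δ * (x ^ β * regSolReal (β + 1) q.re x))
          + ((‖q‖ / q.re) ^ 2 * regSolReal β q.re x)
            * (δ * (x ^ β * besselKReal (β + 1) q.re x / q.re)) := by gcongr; linarith
      _ = _ := by
        rw [← hw]
        field_simp
  have h3 : D * δ = ε / 2 := by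
    rw [hδ]
    field_simp
  rw [hsplit]
  exact (norm_add_le _ _).trans_lt (by linarith)

theorem besselK_zero_zero (hq : 0 < q.re) : besselK 0 q 0 = q⁻¹ := by
  rw [besselK_at_zero one_pos hq]
  simp [Complex.cpow_neg_one]

theorem besselKReal_zero_zero {r : ℝ} (hr : 0 < r) : besselKReal 0 r 0 = r⁻¹ := by
  have := besselK_zero_zero (q := r) (by simpa)
  rw [besselK_ofReal] at this
  exact_mod_cast this

/-- For `β = 0` the boundary term kept in `norm_green_le_sub` tends to `1 / Re q` and exactly
cancels the main term of the bound. -/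
theorem tendsto_green_zero (hq : 0 < q.re) (hM : ∀ y, 0 < y → ‖g y‖ ≤ M) :
    Tendsto (green 0 q g) (𝓝[>] 0) (𝓝 0) := by
  have h1 : Tendsto (besselKReal 0 q.re) (𝓝[>] 0) (𝓝 q.re⁻¹) := by
    have h := tendsto_besselK_zero (β := 0) one_pos (q := q.re) (by simpa)
    rw [besselK_zero_zero (by simpa)] at h
    have := (Complex.continuous_re.tendsto _).comp h
    simp only [Function.comp_def, besselK_ofReal, Complex.ofReal_re] at this
    convert! this using 2
    rw [← Complex.ofReal_inv, Complex.ofReal_re]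
  have h2 := (((((h1.const_mul 1).const_sub (q.re ^ (1 - (0:ℝ)) / q.re ^ 2)).const_mul
    ((‖q‖ / q.re) ^ 2 * M))).div_const (‖q‖ ^ (1 - (0 : ℝ))))
  have h3 : q.re ^ (1 - (0:ℝ)) / q.re ^ 2 - 1 * q.re⁻¹ = 0 := by
    rw [sub_zero, Real.rpow_one]
    have := hq.ne'
    field_simp
    norm_num
  rw [h3, mul_zero, zero_div] at h2
  refine squeeze_zero_norm' ?_ h2
  filter_upwards [self_mem_nhdsWithin] with x hx
  have := norm_green_le_sub le_rfl hq hM hx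
  rwa [regSolReal_zero, coeff, Real.rpow_zero, zero_add, Nat.cast_zero, zero_add, Real.Gamma_one,
    Nat.factorial_zero, Nat.cast_one, mul_one, inv_one, one_mul] at this

/-- By reflection `x ^ β K_{β+1}` is `K_{1-β}`, hence bounded. In each of the two terms of the
derivative a factor of order `x ^ β regSolReal (β + 1)` is left over, and it tends to zero. -/
theorem tendsto_rpow_mul_greenDeriv_zero (hβ : 0 < β) (hq : 0 < q.re)
    (hM : ∀ y, 0 < y → ‖g y‖ ≤ M) :
    Tendsto (fun x => ((x ^ β : ℝ) : ℂ) * greenDeriv β q g x) (𝓝[>] 0) (𝓝 0) := by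
  set c := besselKReal (1 - β) q.re 0 with hc
  have hle : ∀ x, 0 < x → x ^ β * besselKReal (β + 1) q.re x ≤ c := by
    intro x hx
    have h := rpow_mul_besselK β q.re hx
    rw [besselK_ofReal, besselK_ofReal] at h
    have h' : x ^ β * besselKReal (β + 1) q.re x = besselKReal (1 - β) q.re x := by exact_mod_cast h
    rw [h']
    exact besselKReal_le_zero hq hx.le (by linarith)
  have hc0 : 0 ≤ c := besselKReal_nonneg _ _ _
  have hM0 : 0 ≤ M := (norm_nonneg _).trans (hM 1 one_pos)
  have t1 := tendsto_rpow_nhdsGT_zero hβ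
  have t2 : Tendsto (regSolReal (β + 1) q.re) (𝓝[>] 0) (𝓝 (regSolReal (β + 1) q.re 0)) :=
    ((continuous_regSolReal (by linarith) _).tendsto 0).mono_left nhdsWithin_le_nhds
  have t3 : Tendsto (fun x => (‖q‖ * c * ((‖q‖ / q.re) ^ 2 * M * (x ^ β * regSolReal (β + 1) q.re x))
      + ‖q‖ ^ 2 * ((‖q‖ / q.re) ^ 2 * (x ^ β * regSolReal (β + 1) q.re x)) * (M * (c / q.re)))
      / ‖q ^ (1 - β : ℂ)‖) (𝓝[>] 0) (𝓝 0) := by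
    have h := t1.mul t2
    rw [zero_mul] at h
    have h' := (((h.const_mul ((‖q‖ / q.re) ^ 2 * M)).const_mul (‖q‖ * c)).add
      (((h.const_mul ((‖q‖ / q.re) ^ 2)).const_mul (‖q‖ ^ 2)).mul_const (M * (c / q.re)))).div_const
      ‖q ^ (1 - β : ℂ)‖
    simpa using h'
  refine squeeze_zero_norm' ?_ t3
  filter_upwards [self_mem_nhdsWithin] with x hx
  have hx0 : (0 : ℝ) < x := hx
  have p1 := norm_integral_lowerDensity_le hβ.le hq le_rfl hx0.le hM
  rw [Real.zero_rpow hβ.ne', zero_mul, sub_zero] at p1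
  have p2 := norm_integral_upperDensity_le (β := β) hq hx0 fun y hy => hM y (hx0.trans hy)
  have k1 := norm_besselK_le (β := β + 1) hq (Or.inl hx0)
  have k2 := norm_regSol_le (by linarith : 0 ≤ β + 1) hq hx0.le
  have n1 := besselKReal_nonneg (β + 1) q.re x
  have n2 := regSolReal_nonneg (by linarith : 0 ≤ β + 1) q.re hx0.le
  have l1 := hle x hx0
  have p2' : ‖∫ y in Ioi x, upperDensity β q g y‖ ≤ M * (c / q.re) := p2.trans (by gcongr)
  have k1' : x ^ β * ‖besselK (β + 1) q x‖ ≤ c := le_trans (by gcongr) l1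
  rw [greenDeriv, mul_div_assoc', norm_div]
  gcongr
  rw [mul_add]
  refine (norm_add_le _ _).trans ?_
  simp only [norm_mul, norm_neg, norm_pow, Complex.norm_real]
  rw [Real.norm_of_nonneg (by positivity)]
  gcongr ?_ + ?_
  · calc _ = ‖q‖ * (x ^ β * ‖besselK (β + 1) q x‖) * ‖∫ y in 0..x, lowerDensity β q g y‖ := by ring
      _ ≤ _ := by gcongr
  · calc _ = ‖q‖ ^ 2 * (x ^ β * ‖regSol (β + 1) q x‖) * ‖∫ y in Ioi x, upperDensity β q g y‖ := by
          ring
      _ ≤ ‖q‖ ^ 2 * (x ^ β * ((‖q‖ / q.re) ^ 2 * regSolReal (β + 1) q.re x)) * (M * (c / q.re)) := by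
          gcongr
      _ = _ := by ring

end Green

/-! ### Behaviour at the origin of the first-order equation for the derivative -/

section Boundary

variable {β : ℝ} {v h : ℝ → ℂ} {M δ : ℝ}

theorem hasDerivAt_rpow_mul_of_ode {x : ℝ} (hx : 0 < x)
    (hv : HasDerivAt v ((h x - β * v x) / x) x) :
    HasDerivAt (fun x : ℝ => ((x ^ β : ℝ) : ℂ) * v x) (((x ^ (β - 1) : ℝ) : ℂ) * h x) x := by
  convert! (hasDerivAt_ofReal_rpow hx β).mul hv using 1
  have hx0 : (x : ℂ) ≠ 0 := by exact_mod_cast hx.ne'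
  rw [Real.rpow_sub_one hx.ne']
  push_cast
  field_simp
  ring

/-- A solution of `x v' + β v = h` with `x ^ β v → 0` at the origin is bounded by `sup |h| / β`. -/
theorem norm_le_div_of_ode (hβ : 0 < β)
    (hv : ∀ x, 0 < x → HasDerivAt v ((h x - β * v x) / x) x)
    (h0 : Tendsto (fun x : ℝ => ((x ^ β : ℝ) : ℂ) * v x) (𝓝[>] 0) (𝓝 0))
    (hM : ∀ x, 0 < x → x < δ → ‖h x‖ ≤ M) {x : ℝ} (hx : 0 < x) (hxδ : x < δ) :
    ‖v x‖ ≤ M / β := by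
  have hM0 : 0 ≤ M := (norm_nonneg _).trans (hM x hx hxδ)
  set F : ℝ → ℂ := fun x => ((x ^ β : ℝ) : ℂ) * v x with hF
  -- The function `x ^ β v` has derivative bounded by `M y ^ (β - 1)`, the derivative of `(M / β) y
  -- ^ β`. The comparison starts at `e > 0`, and `e → 0` removes the initial value.
  have key : ∀ e, 0 < e → e < x → ‖F x‖ ≤ ‖F e‖ + M / β * x ^ β := by
    intro e he hex
    have hd : ∀ y ∈ Icc e x, HasDerivAt F (((y ^ (β - 1) : ℝ) : ℂ) * h y) y := fun y hy =>
      hasDerivAt_rpow_mul_of_ode (he.trans_le hy.1) (hv y (he.trans_le hy.1))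
    have hB : ∀ y ∈ Icc e x, HasDerivAt (fun y : ℝ => ‖F e‖ + M / β * y ^ β)
        (M * y ^ (β - 1)) y := by
      intro y hy
      convert! ((Real.hasDerivAt_rpow_const (p := β)
        (Or.inl (he.trans_le hy.1).ne')).const_mul (M / β)).const_add ‖F e‖ using 1
      field_simp
    refine image_norm_le_of_norm_deriv_right_le_deriv_boundary' (a := e) (b := x)
      (B := fun y : ℝ => ‖F e‖ + M / β * y ^ β)
      (fun y hy => (hd y hy).continuousAt.continuousWithinAt)
      (fun y hy => (hd y (Ico_subset_Icc_self hy)).hasDerivWithinAt) ?_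
      (fun y hy => (hB y hy).continuousAt.continuousWithinAt)
      (fun y hy => (hB y (Ico_subset_Icc_self hy)).hasDerivWithinAt) ?_ (right_mem_Icc.2 hex.le)
    · have : 0 ≤ M / β * e ^ β := by positivity
      linarith
    · intro y hy
      have hy0 : 0 < y := he.trans_le hy.1
      rw [norm_mul, Complex.norm_real, Real.norm_of_nonneg (by positivity), mul_comm]
      gcongr
      exact hM y hy0 (hy.2.trans hxδ)
  have hlim : Tendsto (fun e => ‖F e‖ + M / β * x ^ β) (𝓝[>] 0) (𝓝 (‖(0 : ℂ)‖ + M / β * x ^ β)) :=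
    h0.norm.add_const _
  rw [norm_zero, zero_add] at hlim
  have hle : ‖F x‖ ≤ M / β * x ^ β := by
    refine ge_of_tendsto hlim ?_
    filter_upwards [Ioo_mem_nhdsGT hx] with e he using key e he.1 he.2
  rw [hF] at hle
  simp only at hle
  rw [norm_mul, Complex.norm_real, Real.norm_of_nonneg (by positivity), mul_comm] at hle
  exact le_of_mul_le_mul_right hle (by positivity)

/-- A function with bounded derivative near the origin has a limit there. -/
theorem exists_tendsto_of_norm_deriv_le {U v : ℝ → ℂ} (hδ : 0 < δ)
    (hU : ∀ x, 0 < x → HasDerivAt U (v x) x) (hM : ∀ x, 0 < x → x < δ → ‖v x‖ ≤ M) :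
    ∃ l, Tendsto U (𝓝[>] 0) (𝓝 l) := by
  have hM0 : 0 ≤ M := (norm_nonneg _).trans (hM (δ / 2) (by positivity) (by linarith))
  have hL : LipschitzOnWith ⟨M, hM0⟩ U (Ioo 0 δ) := by
    refine LipschitzOnWith.of_dist_le_mul fun x hx y hy => ?_
    rw [dist_eq_norm, dist_eq_norm]
    exact Convex.norm_image_sub_le_of_norm_hasDerivWithin_le
      (fun z hz => (hU z hz.1).hasDerivWithinAt) (fun z hz => hM z hz.1 hz.2) (convex_Ioo 0 δ) hy hx
  have hc : Cauchy (map U (𝓝[>] (0 : ℝ))) :=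
    (cauchy_nhds.mono nhdsWithin_le_nhds).map_of_le hL.uniformContinuousOn
      (le_principal_iff.2 (Ioo_mem_nhdsGT hδ))
  exact CompleteSpace.complete hc

/-- A bootstrap: boundedness of `U` and `f` bounds `v`, so `U` is Lipschitz near the origin and has
a limit. Then the right-hand side `lam * U - f` converges, and the same bound applied to `v` minus
its expected limit, on a short interval, makes the difference small. -/
theorem exists_tendsto_of_ode {U f : ℝ → ℂ} {lam : ℂ} {M₁ M₂ : ℝ} {f₀ : ℂ} (hβ : 0 < β)
    (hU : ∀ x, 0 < x → HasDerivAt U (v x) x)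
    (hv : ∀ x, 0 < x → HasDerivAt v ((lam * U x - f x - β * v x) / x) x)
    (h0 : Tendsto (fun x : ℝ => ((x ^ β : ℝ) : ℂ) * v x) (𝓝[>] 0) (𝓝 0))
    (hM₁ : ∀ x, 0 < x → ‖U x‖ ≤ M₁) (hM₂ : ∀ x, 0 < x → ‖f x‖ ≤ M₂)
    (hf : Tendsto f (𝓝[>] 0) (𝓝 f₀)) :
    ∃ l, Tendsto U (𝓝[>] 0) (𝓝 l) ∧ Tendsto v (𝓝[>] 0) (𝓝 ((lam * l - f₀) / β)) := by
  have hβ0 : (β : ℂ) ≠ 0 := by exact_mod_cast hβ.ne'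
  obtain ⟨l, hl⟩ := exists_tendsto_of_norm_deriv_le (M := (‖lam‖ * M₁ + M₂) / β) one_pos hU
    fun x hx hx1 => norm_le_div_of_ode (h := fun x => lam * U x - f x) hβ hv h0 (δ := 1)
      (fun y hy _ => (norm_sub_le _ _).trans (by
        rw [norm_mul]
        gcongr
        · exact hM₁ y hy
        · exact hM₂ y hy)) hx hx1
  refine ⟨l, hl, ?_⟩
  set m := (lam * l - f₀) / β with hm
  have hlim : Tendsto (fun x => lam * U x - f x) (𝓝[>] 0) (𝓝 (lam * l - f₀)) :=
    (hl.const_mul lam).sub hf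
  have hx0 : Tendsto (fun x : ℝ => ((x ^ β : ℝ) : ℂ) * (v x - m)) (𝓝[>] 0) (𝓝 0) := by
    have h1 := (Complex.continuous_ofReal.tendsto 0).comp (tendsto_rpow_nhdsGT_zero hβ)
    have h2 := h0.sub (h1.mul_const m)
    simp only [Complex.ofReal_zero, zero_mul, sub_zero] at h2
    refine h2.congr fun x => ?_
    simp only [Function.comp_apply]
    ring
  rw [Metric.tendsto_nhds]
  intro ε hε
  have hball := (Metric.tendsto_nhds.1 hlim) (ε / 2 * β) (by positivity)
  obtain ⟨δ, hδ, hδ'⟩ := mem_nhdsGT_iff_exists_Ioo_subset.1 hball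
  have hδ0 : (0 : ℝ) < δ := hδ
  filter_upwards [Ioo_mem_nhdsGT hδ0] with x hx
  have := norm_le_div_of_ode (v := fun x => v x - m) (δ := δ) (M := ε / 2 * β)
    (h := fun x => lam * U x - f x - (lam * l - f₀)) hβ ?_ hx0 ?_ hx.1 hx.2
  · rw [dist_eq_norm]
    refine this.trans_lt ?_
    rw [mul_div_cancel_right₀ _ hβ.ne']
    linarith
  · intro y hy
    convert! (hv y hy).sub_const m using 1
    rw [hm]
    field_simp
    ring
  · intro y hy hyδ
    have := hδ' ⟨hy, hyδ⟩
    rw [← dist_eq_norm]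
    exact le_of_lt this

end Boundary

/-! ### Existence and uniqueness on the half-line -/

/-- Bounded solutions of `x u'' + β u' + f = q² u` on `]0,∞[` with the boundary behaviour of the
domain of the degenerate operator. -/
theorem exists_solution {β : ℝ} (hβ : 0 ≤ β) {q : ℂ} (hq : 0 < q.re) {f : ℝ → ℂ} {f₁ : ℂ} {F : ℝ}
    (hf : ContinuousOn f (Ici 0)) (hF : ∀ x, 0 ≤ x → ‖f x‖ ≤ F) (hf₁ : Tendsto f atTop (𝓝 f₁)) :
    ∃ (U v : ℝ → ℂ) (l : ℂ), (∀ x, 0 < x → HasDerivAt U (v x) x) ∧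
      (∀ x, 0 < x → HasDerivAt v ((q ^ 2 * U x - f x - β * v x) / x) x) ∧
      Tendsto U atTop (𝓝 (f₁ / q ^ 2)) ∧ Tendsto U (𝓝[>] 0) (𝓝 l) ∧
      (β = 0 → l = f 0 / q ^ 2) ∧
      (0 < β → Tendsto v (𝓝[>] 0) (𝓝 ((q ^ 2 * l - f 0) / β))) ∧
      ∀ x, 0 < x → ‖U x‖ ≤ (1 + 2 * (‖q‖ / q.re) ^ 4 * (‖q‖ / q.re) ^ (β - 1)
        + 2 * (‖q‖ / q.re)) * (F / ‖q‖ ^ 2) := by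
  have hq0 := ne_zero_of_re_pos hq
  have hqn : 0 < ‖q‖ := norm_pos_iff.2 hq0
  have hF0 : 0 ≤ F := (norm_nonneg _).trans (hF 0 le_rfl)
  have hf₁F : ‖f₁‖ ≤ F := le_of_tendsto hf₁.norm (by
    filter_upwards [eventually_ge_atTop 0] with x hx using hF x hx)
  have hf0 : Tendsto f (𝓝[>] 0) (𝓝 (f 0)) :=
    (hf 0 self_mem_Ici).mono_left (nhdsWithin_mono _ Ioi_subset_Ici_self)
  -- Only the part of `f` that vanishes at infinity goes through the Green operator; the constant
  -- `f₁` has the solution `f₁ / q ^ 2`. This costs a factor `2` in the bound.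
  set g : ℝ → ℂ := fun x => f x - f₁ with hg
  have hgc : ContinuousOn g (Ioi 0) := (hf.mono Ioi_subset_Ici_self).sub continuousOn_const
  have hgM : ∀ y, 0 < y → ‖g y‖ ≤ 2 * F := fun y hy =>
    (norm_sub_le _ _).trans (by linarith [hF y hy.le])
  have hg1 : Tendsto g atTop (𝓝 0) := by simpa using hf₁.sub_const f₁
  -- For `β = 0` the Green part vanishes at the origin and `besselK 0 q 0 = q⁻¹`, so this `c` moves
  -- the boundary value from `f₁ / q ^ 2` to `f 0 / q ^ 2`.
  set c : ℂ := if β = 0 then (f 0 - f₁) / q ^ 2 * q else 0 with hc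
  set U : ℝ → ℂ := fun x => f₁ / q ^ 2 + green β q g x + c * besselK β q x with hU
  set v : ℝ → ℂ := fun x => greenDeriv β q g x + c * (-q * besselK (β + 1) q x) with hv
  have dU : ∀ x, 0 < x → HasDerivAt U (v x) x := fun x hx =>
    ((hasDerivAt_green hβ hq hgc hgM hx).const_add _).add ((hasDerivAt_besselK hq hx).const_mul c)
  have dv : ∀ x, 0 < x → HasDerivAt v ((q ^ 2 * U x - f x - β * v x) / x) x := by
    intro x hx
    convert! (hasDerivAt_greenDeriv hβ hq hgc hgM hx).add
      (((hasDerivAt_besselK (β := β + 1) hq hx).const_mul (-q)).const_mul c) using 1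
    have hx0 : (x : ℂ) ≠ 0 := by exact_mod_cast hx.ne'
    have e1 := mul_besselK_eq β hq hx
    rw [show β + 1 + 1 = β + 2 by ring]
    simp only [hU, hv, hg]
    field_simp
    linear_combination q * c * e1
  have bK : ∀ x, 0 < x → ‖c * besselK β q x‖ ≤ 2 * (‖q‖ / q.re) * (F / ‖q‖ ^ 2) := by
    intro x hx
    by_cases hb : β = 0
    · have k1 := (norm_besselK_le (β := 0) hq (Or.inl hx)).trans
        (besselKReal_le_zero hq hx.le one_pos)
      rw [besselKReal_zero_zero hq] at k1
      rw [hc, if_pos hb, hb, norm_mul, norm_mul, norm_div, norm_pow]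
      have : ‖f 0 - f₁‖ ≤ 2 * F := (norm_sub_le _ _).trans (by linarith [hF 0 le_rfl])
      calc _ ≤ 2 * F / ‖q‖ ^ 2 * ‖q‖ * q.re⁻¹ := by gcongr
        _ = _ := by ring
    · rw [hc, if_neg hb, zero_mul, norm_zero]
      positivity
  have bU : ∀ x, 0 < x → ‖U x‖ ≤ (1 + 2 * (‖q‖ / q.re) ^ 4 * (‖q‖ / q.re) ^ (β - 1)
      + 2 * (‖q‖ / q.re)) * (F / ‖q‖ ^ 2) := by
    intro x hx
    have b1 : ‖f₁ / q ^ 2‖ ≤ F / ‖q‖ ^ 2 := by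
      rw [norm_div, norm_pow]
      gcongr
    have b2 := norm_green_le hβ hq hgM hx
    have b2' : (‖q‖ / q.re) ^ 2 * (2 * F) * (q.re ^ (1 - β) / q.re ^ 2) / ‖q‖ ^ (1 - β)
        = 2 * (‖q‖ / q.re) ^ 4 * (‖q‖ / q.re) ^ (β - 1) * (F / ‖q‖ ^ 2) := by
      rw [← neg_sub 1 β, Real.rpow_neg (by positivity), Real.div_rpow hqn.le hq.le]
      field_simp
    rw [b2'] at b2
    refine (norm_add_le _ _).trans ((add_le_add ((norm_add_le _ _).trans (add_le_add b1 b2))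
      (bK x hx)).trans_eq ?_)
    ring
  have lU : Tendsto U atTop (𝓝 (f₁ / q ^ 2)) := by
    have := ((tendsto_green_atTop hβ hq hgc hgM hg1).const_add (f₁ / q ^ 2)).add
      ((tendsto_besselK_atTop β hq).const_mul c)
    simpa using this
  rcases hβ.eq_or_lt with rfl | hb
  · refine ⟨U, v, f 0 / q ^ 2, dU, dv, lU, ?_, fun _ => rfl, fun h => (lt_irrefl _ h).elim, bU⟩
    have h := ((tendsto_green_zero hq hgM).const_add (f₁ / q ^ 2)).add
      ((tendsto_besselK_zero one_pos hq).const_mul c)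
    rw [besselK_zero_zero hq] at h
    have hc' : c = (f 0 - f₁) / q ^ 2 * q := if_pos rfl
    have e : f 0 / q ^ 2 = f₁ / q ^ 2 + 0 + c * q⁻¹ := by
      rw [hc']
      field_simp
      ring
    rw [e]
    exact h
  · have hc0 : c = 0 := if_neg hb.ne'
    have h0 : Tendsto (fun x : ℝ => ((x ^ β : ℝ) : ℂ) * v x) (𝓝[>] 0) (𝓝 0) := by
      simp only [hv, hc0, zero_mul, add_zero]
      exact tendsto_rpow_mul_greenDeriv_zero hb hq hgM
    obtain ⟨l, h1, h2⟩ := exists_tendsto_of_ode hb dU dv h0 bU (fun x hx => hF x hx.le) hf0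
    exact ⟨U, v, l, dU, dv, lU, h1, fun h => (hb.ne' h).elim, fun _ => h2, bU⟩

/-- Uniqueness of bounded solutions of the homogeneous equation. -/
theorem eq_zero_of_homogeneous {β : ℝ} (hβ : 0 ≤ β) {q : ℂ} (hq : 0 < q.re) {U v : ℝ → ℂ} {M : ℝ}
    (hU : ∀ x, 0 < x → HasDerivAt U (v x) x)
    (hv : ∀ x, 0 < x → HasDerivAt v ((q ^ 2 * U x - β * v x) / x) x)
    (hM : ∀ x, 0 < x → ‖U x‖ ≤ M) (h0 : β = 0 → Tendsto U (𝓝[>] 0) (𝓝 0))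
    (h1 : 0 < β → Tendsto (fun x : ℝ => ((x ^ β : ℝ) : ℂ) * v x) (𝓝[>] 0) (𝓝 0))
    {x : ℝ} (hx : 0 < x) : U x = 0 := by
  have hq0 := ne_zero_of_re_pos hq
  have hM0 : 0 ≤ M := (norm_nonneg _).trans (hM x hx)
  set N : ℝ → ℂ := fun x => ((x ^ β : ℝ) : ℂ) * v x with hN
  have dN : ∀ y, 0 < y → HasDerivAt N (((y ^ (β - 1) : ℝ) : ℂ) * (q ^ 2 * U y)) y := fun y hy =>
    hasDerivAt_rpow_mul_of_ode (h := fun y => q ^ 2 * U y) hy (hv y hy)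
  -- Here `b` and `a` are the weighted Wronskians of `U` with the decaying and the regular solution;
  -- both are constant.
  set b : ℝ → ℂ := fun y => N y * besselK β q y
    + q * (U y * (((y ^ β : ℝ) : ℂ) * besselK (β + 1) q y)) with hb
  set a : ℝ → ℂ := fun y => N y * regSol β q y
    - q ^ 2 * (U y * (((y ^ β : ℝ) : ℂ) * regSol (β + 1) q y)) with ha
  have db : ∀ y, 0 < y → HasDerivAt b 0 y := by
    intro y hy
    convert! ((dN y hy).mul (hasDerivAt_besselK (β := β) hq hy)).add
      (((hU y hy).mul (hasDerivAt_rpow_mul_besselK β hq hy)).const_mul q) using 1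
    simp only [hN]
    ring
  have da : ∀ y, 0 < y → HasDerivAt a 0 y := by
    intro y hy
    convert! ((dN y hy).mul (hasDerivAt_regSol hβ q y)).sub
      (((hU y hy).mul (hasDerivAt_rpow_mul_regSol hβ q hy)).const_mul (q ^ 2)) using 1
    simp only [hN]
    ring
  -- No decay of `v` is known, but polynomial growth of `N` is enough against the decay of
  -- `besselK`, and it gives `b = 0`.
  have growth : ∀ y, 1 ≤ y → ‖N y‖ ≤ ‖N 1‖ + ‖q‖ ^ 2 * M * y ^ (β + 1) := by
    intro y hy
    have hy0 : 0 < y := by linarith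
    have hC : ∀ z ∈ Icc 1 y, ‖((z ^ (β - 1) : ℝ) : ℂ) * (q ^ 2 * U z)‖ ≤ ‖q‖ ^ 2 * M * y ^ β := by
      intro z hz
      have hz0 : 0 < z := by linarith [hz.1]
      rw [norm_mul, norm_mul, norm_pow, Complex.norm_real, Real.norm_of_nonneg (by positivity),
        mul_comm]
      have i1 : z ^ (β - 1) ≤ y ^ β :=
        (Real.rpow_le_rpow_of_exponent_le hz.1 (by linarith)).trans
          (Real.rpow_le_rpow hz0.le hz.2 hβ)
      have i2 := hM z hz0
      gcongr
    have := Convex.norm_image_sub_le_of_norm_hasDerivWithin_le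
      (fun z hz => (dN z (by linarith [hz.1])).hasDerivWithinAt) hC (convex_Icc 1 y)
      (left_mem_Icc.2 hy) (right_mem_Icc.2 hy)
    have i3 : ‖N y‖ ≤ ‖N 1‖ + ‖N y - N 1‖ := by
      have := norm_add_le (N 1) (N y - N 1)
      rwa [add_sub_cancel] at this
    have i4 : ‖y - 1‖ ≤ y := by
      rw [Real.norm_of_nonneg (by linarith)]
      linarith
    refine i3.trans (add_le_add le_rfl (this.trans ?_))
    rw [Real.rpow_add_one hy0.ne', ← mul_assoc]
    gcongr
  have limb : Tendsto b atTop (𝓝 0) := by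
    have k0 := (tendsto_rpow_mul_besselKReal_atTop 0 β hq).const_mul ‖N 1‖
    have k1 := (tendsto_rpow_mul_besselKReal_atTop (β + 1) β hq).const_mul (‖q‖ ^ 2 * M)
    have k2 := (tendsto_rpow_mul_besselKReal_atTop β (β + 1) hq).const_mul (‖q‖ * M)
    have k := (k0.add k1).add k2
    simp only [mul_zero, add_zero, Real.rpow_zero, one_mul] at k
    refine squeeze_zero_norm' ?_ k
    filter_upwards [eventually_ge_atTop 1] with y hy
    have hy0 : 0 < y := by linarith
    have n1 := norm_besselK_le (β := β) hq (Or.inl hy0)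
    have n2 := norm_besselK_le (β := β + 1) hq (Or.inl hy0)
    have n3 := besselKReal_nonneg β q.re y
    have n4 := besselKReal_nonneg (β + 1) q.re y
    have m3 : ‖((y ^ β : ℝ) : ℂ) * besselK (β + 1) q y‖ ≤ y ^ β * besselKReal (β + 1) q.re y := by
      rw [norm_mul, Complex.norm_real, Real.norm_of_nonneg (by positivity)]
      gcongr
    refine (norm_add_le _ _).trans ?_
    rw [norm_mul (N y), norm_mul q, norm_mul (U y)]
    have m1 := growth y hy
    have m2 := hM y hy0
    calc _ ≤ (‖N 1‖ + ‖q‖ ^ 2 * M * y ^ (β + 1)) * besselKReal β q.re y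
          + ‖q‖ * (M * (y ^ β * besselKReal (β + 1) q.re y)) := by gcongr
      _ = _ := by ring
  have hb0 : ∀ y, 0 < y → b y = 0 := fun y hy =>
    eq_of_hasDerivAt_zero_of_tendsto db (eventually_gt_atTop 0) limb hy
  have hw0 : q ^ (1 - β : ℂ) ≠ 0 := by simp [Complex.cpow_eq_zero_iff, hq0]
  -- Eliminating `v` gives `U * wronsk = regSol * b - besselK * a`, and `b = 0`.
  have rel : ∀ y, 0 < y → U y * q ^ (1 - β : ℂ) = -(a y * besselK β q y) := by
    intro y hy
    have e := hb0 y hy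
    rw [← wronsk_eq hβ hq hy, wronsk]
    simp only [hb] at e
    simp only [ha]
    linear_combination regSol β q y * e
  -- The condition at the origin enters here. For `β = 0`, `U → 0` while `besselK` tends to `q⁻¹ ≠
  -- 0`, so the constant is zero. For `β > 0`, both terms of `a` tend to zero.
  have ha0 : a x = 0 := by
    rcases hβ.eq_or_lt with hb' | hb'
    · have hl : Tendsto (fun y => U y * q ^ (1 - β : ℂ)) (𝓝[>] 0) (𝓝 0) := by
        simpa using (h0 hb'.symm).mul_const (q ^ (1 - β : ℂ))
      have hr : Tendsto (fun y => -(a x * besselK β q y)) (𝓝[>] 0)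
          (𝓝 (-(a x * q⁻¹))) := by
        rw [← besselK_zero_zero hq, ← hb']
        exact ((tendsto_besselK_zero one_pos hq).const_mul _).neg
      have := tendsto_nhds_unique (hl.congr' (by
        filter_upwards [self_mem_nhdsWithin] with y hy
        rw [rel y hy, eq_of_hasDerivAt_zero da hy hx])) hr
      simpa [hq0] using this.symm
    · refine eq_of_hasDerivAt_zero_of_tendsto (F := 𝓝[>] 0) da self_mem_nhdsWithin ?_ hx
      have r1 : ∀ β, 0 ≤ β → Tendsto (regSol β q) (𝓝[>] 0) (𝓝 (regSol β q 0)) := fun β hβ =>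
        ((continuous_regSol hβ q).tendsto 0).mono_left nhdsWithin_le_nhds
      have r2 : Tendsto (fun y : ℝ => U y * (((y ^ β : ℝ) : ℂ) * regSol (β + 1) q y)) (𝓝[>] 0)
          (𝓝 0) := by
        have t := (Complex.continuous_ofReal.tendsto 0).comp (tendsto_rpow_nhdsGT_zero hb')
        have t' := (t.mul (r1 (β + 1) (by linarith)))
        rw [Complex.ofReal_zero, zero_mul] at t'
        have t'' := (t'.norm.const_mul M)
        rw [norm_zero, mul_zero] at t''
        refine squeeze_zero_norm' ?_ t''
        filter_upwards [self_mem_nhdsWithin] with y hy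
        rw [norm_mul]
        have := hM y hy
        gcongr
        exact le_rfl
      have := ((h1 hb').mul (r1 β hβ)).sub (r2.const_mul (q ^ 2))
      simpa using this
  have := rel x hx
  rw [ha0, zero_mul, neg_zero] at this
  exact (mul_eq_zero.1 this).resolve_right hw0

end BesselKernel

/-! ### From the differential equation to the resolvent of the operator -/

namespace DegenerateDiffusion

section Abstract

variable {E : Type*} [NormedAddCommGroup E] [NormedSpace ℂ E]

/-- A resolvent exists as soon as `λ - T` is injective and has solutions with a norm bound. -/
theorem exists_isResolventAt {T : E →ₗ.[ℂ] E} {lam : ℂ} {C : ℝ}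
    (hinj : ∀ u : T.domain, lam • (u : E) - T u = 0 → u = 0)
    (hsurj : ∀ f : E, ∃ u : T.domain, lam • (u : E) - T u = f ∧ ‖(u : E)‖ ≤ C * ‖f‖) :
    ∃ R : E →L[ℂ] E, IsResolventAt T lam R ∧ ∀ f, ‖R f‖ ≤ C * ‖f‖ := by
  choose S hS hSC using hsurj
  have huniq : ∀ u w : T.domain, lam • (u : E) - T u = lam • (w : E) - T w → u = w := by
    intro u w h
    rw [← sub_eq_zero]
    apply hinj
    rw [LinearPMap.map_sub, Submodule.coe_sub, smul_sub]
    rw [← sub_eq_zero] at h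
    rw [← h]
    abel
  let L : E →ₗ[ℂ] E :=
    { toFun := fun f => (S f : E)
      map_add' := fun f g => by
        rw [← Submodule.coe_add]
        congr 1
        apply huniq
        rw [hS, LinearPMap.map_add, Submodule.coe_add, smul_add, add_sub_add_comm, hS, hS]
      map_smul' := fun c f => by
        rw [RingHom.id_apply, ← Submodule.coe_smul]
        congr 1
        apply huniq
        rw [hS, LinearPMap.map_smul, Submodule.coe_smul, smul_comm, ← smul_sub, hS] }
  refine ⟨L.mkContinuous C hSC, ⟨fun f => ⟨(S f).2, hS f⟩, fun u => ?_⟩, hSC⟩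
  exact congrArg Subtype.val (huniq (S (lam • (u : E) - T u)) u (hS _))

theorem resolvent_eq {T : E →ₗ.[ℂ] E} {lam : ℂ} {R : E →L[ℂ] E} (hR : IsResolventAt T lam R) :
    resolvent T lam = R := by
  have h : ∃ R : E →L[ℂ] E, IsResolventAt T lam R := ⟨R, hR⟩
  rw [resolvent, dif_pos h]
  exact h.choose_spec.unique hR

end Abstract

theorem ext_apply_of_nonneg (u : CInfty) {x : ℝ} (hx : 0 ≤ x) :
    ext u x = (u : ℝ≥0 →ᵇ ℂ) ⟨x, hx⟩ := by
  rw [ext, Real.toNNReal_of_nonneg hx]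
  rfl

theorem continuous_ext (u : CInfty) : Continuous (ext u) :=
  (u : ℝ≥0 →ᵇ ℂ).continuous.comp continuous_real_toNNReal

theorem norm_ext_le (u : CInfty) (x : ℝ) : ‖ext u x‖ ≤ ‖u‖ :=
  (u : ℝ≥0 →ᵇ ℂ).norm_coe_le_norm _

theorem exists_tendsto_ext (u : CInfty) : ∃ l, Tendsto (ext u) atTop (𝓝 l) := by
  obtain ⟨l, hl⟩ := u.2
  exact ⟨l, hl.comp Real.tendsto_toNNReal_atTop⟩

/-- A continuous bounded function on `]0,∞[` with limits at both ends defines an element of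
`C([0,∞])`. -/
theorem exists_cInfty {U : ℝ → ℂ} {l l₁ : ℂ} {C : ℝ} (hU : ContinuousOn U (Ioi 0))
    (h0 : Tendsto U (𝓝[>] 0) (𝓝 l)) (h1 : Tendsto U atTop (𝓝 l₁)) (hC : ∀ x, 0 < x → ‖U x‖ ≤ C) :
    ∃ u : CInfty, ext u 0 = l ∧ (∀ x, 0 < x → ext u x = U x) ∧ ‖u‖ ≤ C := by
  have hC0 : 0 ≤ C := (norm_nonneg _).trans (hC 1 one_pos)
  set V : ℝ → ℂ := Function.update U 0 l with hV
  have hVU : ∀ x, 0 < x → V x = U x := fun x hx => Function.update_of_ne hx.ne' _ _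
  have hVc : ContinuousOn V (Ici 0) := by
    intro x hx
    rcases (mem_Ici.1 hx).eq_or_lt with rfl | hx
    · rw [hV, continuousWithinAt_update_same, Ici_sdiff_left]
      exact h0
    · refine ContinuousAt.continuousWithinAt ((hU.continuousAt (Ioi_mem_nhds hx)).congr ?_)
      filter_upwards [Ioi_mem_nhds hx] with y hy using (hVU y hy).symm
  have hVC : ∀ x, 0 ≤ x → ‖V x‖ ≤ C := by
    intro x hx
    rcases hx.eq_or_lt with rfl | hx
    · rw [hV, Function.update_self]
      exact le_of_tendsto h0.norm (by filter_upwards [self_mem_nhdsWithin] with y hy using hC y hy)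
    · rw [hVU x hx]
      exact hC x hx
  have hcont : Continuous fun x : ℝ≥0 => V x :=
    hVc.comp_continuous NNReal.continuous_coe fun x => x.2
  refine ⟨⟨BoundedContinuousFunction.ofNormedAddCommGroup (fun x : ℝ≥0 => V x) hcont C
    fun x => hVC x x.2, l₁, ?_⟩, ?_, ?_, ?_⟩
  · have : Tendsto V atTop (𝓝 l₁) := h1.congr' (by
      filter_upwards [eventually_gt_atTop 0] with x hx using (hVU x hx).symm)
    exact this.comp (NNReal.tendsto_coe_atTop.2 tendsto_id)
  · simp [ext, hV]
  · intro x hx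
    rw [← hVU x hx, ext]
    simp [hx.le]
  · exact BoundedContinuousFunction.norm_ofNormedAddCommGroup_le hcont hC0 fun x => hVC x x.2

theorem contDiffOn_two_of_hasDerivAt {U v w : ℝ → ℂ} (hU : ∀ x, 0 < x → HasDerivAt U (v x) x)
    (hv : ∀ x, 0 < x → HasDerivAt v (w x) x) (hw : ContinuousOn w (Ioi 0)) :
    ContDiffOn ℝ 2 U (Ioi 0) := by
  have h1 : ContDiffOn ℝ 1 v (Ioi 0) := by
    rw [contDiffOn_one_iff_derivWithin isOpen_Ioi.uniqueDiffOn]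
    refine ⟨fun x hx => (hv x hx).differentiableAt.differentiableWithinAt, ?_⟩
    refine hw.congr fun x hx => ?_
    rw [derivWithin_of_isOpen isOpen_Ioi hx, (hv x hx).deriv]
  have h2 : ContDiffOn ℝ (1 + 1) U (Ioi 0) := by
    rw [contDiffOn_succ_iff_deriv_of_isOpen isOpen_Ioi]
    refine ⟨fun x hx => (hU x hx).differentiableAt.differentiableWithinAt, by simp, ?_⟩
    exact h1.congr fun x hx => (hU x hx).deriv
  rwa [one_add_one_eq_two] at h2

/-- The domain conditions become those of `eq_zero_of_homogeneous`. For `b = 0`, `A u → 0` at the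
origin and the equation force `u → 0` there; for `b > 0`, continuity of `u'` up to the origin gives
`x ^ β u' → 0`. -/
theorem injective_sub {γ b : ℝ} (hγ : 0 < γ) (hb : 0 ≤ b) {q : ℂ} (hq : 0 < q.re)
    (u : (A γ b).domain) (h : ((γ : ℂ) * q ^ 2) • (u : CInfty) - A γ b u = 0) : u = 0 := by
  obtain ⟨u, hu⟩ := u
  have hu' : InDomain γ b u := hu
  have hγ0 : (γ : ℂ) ≠ 0 := by exact_mod_cast hγ.ne'
  have hpt : ∀ x : ℝ, 0 ≤ x → γ * q ^ 2 * ext u x = expr γ b u x := by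
    intro x hx
    have h' := congrArg (fun w : CInfty => (w : ℝ≥0 →ᵇ ℂ) ⟨x, hx⟩) (sub_eq_zero.1 h)
    rw [ext_apply_of_nonneg u hx]
    exact h'
  have hU : ∀ x, 0 < x → HasDerivAt (ext u) (deriv (ext u) x) x := fun x hx =>
    (differentiableAt_ext hu'.contDiffOn_two hx).hasDerivAt
  have hv : ∀ x, 0 < x → HasDerivAt (deriv (ext u))
      ((q ^ 2 * ext u x - (b / γ : ℝ) * deriv (ext u) x) / x) x := by
    intro x hx
    have h1 := (differentiableAt_deriv hu'.contDiffOn_two hx).hasDerivAt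
    convert! h1 using 1
    have h2 := hpt x hx.le
    rw [expr, d1_eq_deriv u hx, d2] at h2
    have hx0 : (x : ℂ) ≠ 0 := by exact_mod_cast hx.ne'
    push_cast
    field_simp
    linear_combination h2
  have hzero : ∀ x, 0 < x → ext u x = 0 := by
    intro x hx
    refine BesselKernel.eq_zero_of_homogeneous (by positivity : 0 ≤ b / γ) hq hU hv
      (fun y _ => norm_ext_le u y) ?_ ?_ hx
    · intro hb0
      have hb0' : b = 0 := by
        rcases div_eq_zero_iff.1 hb0 with h | h
        · exact h
        · exact (hγ.ne' h).elim
      have ht := (hu'.tendsto_zero_of_eq hb0').const_mul ((γ * q ^ 2 : ℂ)⁻¹)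
      rw [mul_zero] at ht
      refine ht.congr' ?_
      filter_upwards [self_mem_nhdsWithin] with y hy
      have hq0 := BesselKernel.ne_zero_of_re_pos hq
      rw [← hpt y (le_of_lt hy)]
      field_simp
    · intro hbp
      have hb0 : b ≠ 0 := by
        rintro rfl
        simp at hbp
      have hc : ContinuousWithinAt (d1 u) (Ici 0) 0 :=
        (hu'.contDiffOn_one hb0).continuousOn_derivWithin (uniqueDiffOn_Ici 0) le_rfl 0
          self_mem_Ici
      have hc' : Tendsto (d1 u) (𝓝[>] 0) (𝓝 (d1 u 0)) := hc.mono Ioi_subset_Ici_self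
      have ht := ((Complex.continuous_ofReal.tendsto 0).comp
        (BesselKernel.tendsto_rpow_nhdsGT_zero hbp)).mul hc'
      rw [Complex.ofReal_zero, zero_mul] at ht
      refine ht.congr' ?_
      filter_upwards [self_mem_nhdsWithin] with y hy
      rw [d1_eq_deriv u hy]
      rfl
  have h0 : ext u 0 = 0 := by
    have t1 : Tendsto (ext u) (𝓝[>] 0) (𝓝 (ext u 0)) :=
      ((continuous_ext u).tendsto 0).mono_left nhdsWithin_le_nhds
    refine tendsto_nhds_unique t1 (tendsto_const_nhds.congr' ?_)
    filter_upwards [self_mem_nhdsWithin] with y hy using (hzero y hy).symm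
  apply Subtype.ext
  apply Subtype.ext
  ext x
  have hx := ext_apply_of_nonneg u x.2
  refine hx.symm.trans ?_
  rcases x.2.eq_or_lt with h | h
  · rw [← h]
    exact h0
  · exact hzero _ h

theorem surjective_sub {γ b : ℝ} (hγ : 0 < γ) (hb : 0 ≤ b) {q : ℂ} (hq : 0 < q.re) (f : CInfty) :
    ∃ u : (A γ b).domain, ((γ : ℂ) * q ^ 2) • (u : CInfty) - A γ b u = f ∧
      ‖(u : CInfty)‖ ≤ (1 + 2 * (‖q‖ / q.re) ^ 4 * (‖q‖ / q.re) ^ (b / γ - 1)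
        + 2 * (‖q‖ / q.re)) / ‖(γ : ℂ) * q ^ 2‖ * ‖f‖ := by
  have hγ0 : (γ : ℂ) ≠ 0 := by exact_mod_cast hγ.ne'
  have hq0 := BesselKernel.ne_zero_of_re_pos hq
  have hβ : 0 ≤ b / γ := by positivity
  obtain ⟨f₁, hf₁⟩ := exists_tendsto_ext f
  obtain ⟨U, v, l, dU, dv, t1, t0, l0, lv, hbound⟩ := BesselKernel.exists_solution hβ hq
    (f := fun x => ext f x / γ) (F := ‖f‖ / γ)
    ((continuous_ext f).div_const _).continuousOn (fun x _ => by
      rw [norm_div, Complex.norm_real, Real.norm_of_nonneg hγ.le]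
      gcongr
      exact norm_ext_le f x) (hf₁.div_const _)
  have cU : ContinuousOn U (Ioi 0) := fun x hx => (dU x hx).continuousAt.continuousWithinAt
  have cv : ContinuousOn v (Ioi 0) := fun x hx => (dv x hx).continuousAt.continuousWithinAt
  obtain ⟨u, hu0, hu, hunorm⟩ := exists_cInfty cU t0 t1 hbound
  have du : ∀ x, 0 < x → HasDerivAt (ext u) (v x) x := fun x hx =>
    (dU x hx).congr_of_eventuallyEq (by
      filter_upwards [Ioi_mem_nhds hx] with y hy using hu y hy)
  have e1 : ∀ x, 0 < x → d1 u x = v x := fun x hx => by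
    rw [d1_eq_deriv u hx, (du x hx).deriv]
  have e2 : ∀ x, 0 < x → d2 u x = (q ^ 2 * U x - ext f x / γ - (b / γ : ℝ) * v x) / x := by
    intro x hx
    refine ((dv x hx).congr_of_eventuallyEq ?_).deriv
    filter_upwards [Ioi_mem_nhds hx] with y hy using (du y hy).deriv
  have hex : ∀ x, 0 < x → expr γ b u x = γ * q ^ 2 * U x - ext f x := by
    intro x hx
    have hx0 : (x : ℂ) ≠ 0 := by exact_mod_cast hx.ne'
    rw [expr, e1 x hx, e2 x hx]
    push_cast
    field_simp
    ring
  have tf0 : Tendsto (ext f) (𝓝[>] 0) (𝓝 (ext f 0)) :=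
    ((continuous_ext f).tendsto 0).mono_left nhdsWithin_le_nhds
  have hbγ : b ≠ 0 → 0 < b / γ := fun h => div_pos (lt_of_le_of_ne hb (Ne.symm h)) hγ
  have hbγ0 : b ≠ 0 → ((b / γ : ℝ) : ℂ) ≠ 0 := fun h => by exact_mod_cast (hbγ h).ne'
  -- The one-sided derivative at the origin exists because `u` is continuous there and its
  -- derivatives converge.
  have d0 : b ≠ 0 → HasDerivWithinAt (ext u)
      ((q ^ 2 * l - ext f 0 / γ) / (b / γ : ℝ)) (Ici 0) 0 := by
    intro h
    refine hasDerivWithinAt_Ici_of_tendsto_deriv (s := Ioi 0)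
      (fun x hx => (du x hx).differentiableAt.differentiableWithinAt)
      (continuous_ext u).continuousWithinAt self_mem_nhdsWithin ?_
    refine (lv (hbγ h)).congr' ?_
    filter_upwards [self_mem_nhdsWithin] with y hy using (du y hy).deriv.symm
  have hdom : InDomain γ b u :=
    { contDiffOn_two := by
        refine contDiffOn_two_of_hasDerivAt du dv ?_
        refine ContinuousOn.div (((cU.const_mul _).sub
          ((continuous_ext f).div_const _).continuousOn).sub (cv.const_mul _))
          Complex.continuous_ofReal.continuousOn fun x hx => ?_
        exact_mod_cast (mem_Ioi.1 hx).ne'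
      tendsto_atTop := by
        have h := (t1.const_mul (γ * q ^ 2 : ℂ)).sub hf₁
        rw [show (γ * q ^ 2 : ℂ) * (f₁ / γ / q ^ 2) - f₁ = 0 by field_simp; ring] at h
        refine h.congr' ?_
        filter_upwards [eventually_gt_atTop 0] with x hx using (hex x hx).symm
      tendsto_zero_of_eq := by
        intro hb0
        have h := (t0.const_mul (γ * q ^ 2 : ℂ)).sub tf0
        rw [l0 (by simp [hb0]),
          show (γ * q ^ 2 : ℂ) * (ext f 0 / γ / q ^ 2) - ext f 0 = 0 by field_simp; ring] at h
        refine h.congr' ?_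
        filter_upwards [self_mem_nhdsWithin] with x hx using (hex x hx).symm
      contDiffOn_one := by
        intro h
        rw [contDiffOn_one_iff_derivWithin (uniqueDiffOn_Ici 0)]
        refine ⟨fun x hx => ?_, fun x hx => ?_⟩
        · rcases (mem_Ici.1 hx).eq_or_lt with rfl | hx
          · exact (d0 h).differentiableWithinAt
          · exact (du x hx).differentiableAt.differentiableWithinAt
        · rcases (mem_Ici.1 hx).eq_or_lt with rfl | hx
          · rw [← continuousWithinAt_Ioi_iff_Ici]
            unfold ContinuousWithinAt
            rw [(d0 h).derivWithin (uniqueDiffOn_Ici 0 0 self_mem_Ici)]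
            refine (lv (hbγ h)).congr' ?_
            filter_upwards [self_mem_nhdsWithin] with y hy using (e1 y hy).symm
          · refine ContinuousAt.continuousWithinAt ((dv x hx).continuousAt.congr ?_)
            filter_upwards [Ioi_mem_nhds hx] with y hy using (e1 y hy).symm
      tendsto_zero_of_ne := by
        intro h
        -- By the equation `x u'' = q² u - f / γ - β u'`, and the limit of `u'` is exactly the value
        -- for which the right-hand side tends to zero.
        have h1 := ((t0.const_mul (q ^ 2)).sub (tf0.div_const (γ : ℂ))).sub
          ((lv (hbγ h)).const_mul ((b / γ : ℝ) : ℂ))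
        rw [mul_div_cancel₀ _ (hbγ0 h), sub_self] at h1
        refine h1.congr' ?_
        filter_upwards [self_mem_nhdsWithin] with x hx
        have hx0 : (x : ℂ) ≠ 0 := by exact_mod_cast (mem_Ioi.1 hx).ne'
        rw [e2 x hx, mul_div_cancel₀ _ hx0] }
  refine ⟨⟨u, hdom⟩, ?_, ?_⟩
  · have hpt : ∀ x : ℝ, 0 ≤ x → γ * q ^ 2 * ext u x - expr γ b u x = ext f x := by
      intro x hx
      rcases hx.eq_or_lt with rfl | hx
      · have h0 : expr γ b u 0 = b * d1 u 0 := by simp [expr]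
        rw [h0, hu0]
        by_cases hb0 : b = 0
        · rw [l0 (by simp [hb0]), hb0]
          push_cast
          field_simp
          ring
        · have hbc : (b : ℂ) ≠ 0 := by exact_mod_cast hb0
          rw [d1, (d0 hb0).derivWithin (uniqueDiffOn_Ici 0 0 self_mem_Ici)]
          push_cast
          field_simp
          ring
      · rw [hex x hx, hu x hx]
        ring
    apply Subtype.ext
    ext x
    have hext (v : CInfty) : ext v x = (v : ℝ≥0 →ᵇ ℂ) x := ext_apply_of_nonneg v x.2
    have := hpt x x.2
    rw [hext u, hext f] at this
    exact this
  · refine hunorm.trans_eq ?_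
    rw [norm_mul, norm_pow, Complex.norm_real, Real.norm_of_nonneg hγ.le,
      div_div, div_mul_eq_mul_div, mul_div_assoc]

end DegenerateDiffusion

/-! ### Uniform constants over the sector -/

theorem corollary4p2 (B γ₀ : ℝ) (hB : 0 < B) (hγ₀ : 0 < γ₀) :
    ∃ θ₁ : ℝ, 0 < θ₁ ∧ θ₁ ≤ Real.pi / 2 ∧
      ∀ θ : ℝ, 0 < θ → θ < θ₁ →
        ∃ d₁ : ℝ, 0 < d₁ ∧
          ∀ γ b : ℝ, γ₀ ≤ γ → 0 ≤ b → b ≤ B →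
            ∀ lam : ℂ, lam ≠ 0 → |lam.arg| ≤ Real.pi / 2 + θ →
              lam ∈ DegenerateDiffusion.resolventSet (DegenerateDiffusion.A γ b) ∧
                ∀ f : DegenerateDiffusion.CInfty,
                  ‖DegenerateDiffusion.resolvent (DegenerateDiffusion.A γ b) lam f‖ ≤
                    d₁ * (‖f‖ / ‖lam‖) := by
  -- The largest admissible angle works: halving `arg λ` gives at most `π / 4 + θ / 2 < π / 2`, so
  -- the root `q` stays away from the imaginary axis, with `‖q‖ / Re q ≤ κ₀`.
  refine ⟨Real.pi / 2, by positivity, le_rfl, fun θ hθ hθ₁ => ?_⟩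
  set κ₀ : ℝ := (Real.cos (Real.pi / 4 + θ / 2))⁻¹ with hκ₀
  have hcos : 0 < Real.cos (Real.pi / 4 + θ / 2) :=
    Real.cos_pos_of_mem_Ioo ⟨by linarith [Real.pi_pos], by linarith⟩
  have hκ₀1 : 1 ≤ κ₀ := (one_le_inv₀ hcos).2 (Real.cos_le_one _)
  refine ⟨1 + 2 * κ₀ ^ 4 * κ₀ ^ (B / γ₀) + 2 * κ₀, by positivity, ?_⟩
  intro γ b hγ hb hbB lam hlam harg
  have hγ0 : 0 < γ := hγ₀.trans_le hγ
  have hγc : (γ : ℂ) ≠ 0 := by exact_mod_cast hγ0.ne'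
  have hlamn : 0 < ‖lam‖ := norm_pos_iff.2 hlam
  set ρ : ℝ := √(‖lam‖ / γ) with hρ
  have hρ0 : 0 < ρ := Real.sqrt_pos.2 (by positivity)
  set q : ℂ := ρ * Complex.exp ((lam.arg / 2 : ℝ) * Complex.I) with hqdef
  have hqre : q.re = ρ * Real.cos (lam.arg / 2) := by
    rw [hqdef, Complex.re_ofReal_mul, Complex.exp_ofReal_mul_I_re]
  have hqn : ‖q‖ = ρ := by
    rw [hqdef, norm_mul, Complex.norm_exp_ofReal_mul_I, Complex.norm_real,
      Real.norm_of_nonneg hρ0.le, mul_one]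
  have hcosle : Real.cos (Real.pi / 4 + θ / 2) ≤ Real.cos (lam.arg / 2) := by
    rw [← Real.cos_abs (lam.arg / 2)]
    apply Real.cos_le_cos_of_nonneg_of_le_pi (abs_nonneg _) (by linarith [Real.pi_pos])
    rw [abs_div, abs_two]
    linarith
  have hcos' := hcos.trans_le hcosle
  have hq : 0 < q.re := by
    rw [hqre]
    positivity
  have hq2 : (γ : ℂ) * q ^ 2 = lam := by
    rw [hqdef, mul_pow, ← Complex.exp_nat_mul, ← Complex.ofReal_pow, hρ,
      Real.sq_sqrt (by positivity)]
    conv_rhs => rw [← Complex.norm_mul_exp_arg_mul_I lam]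
    push_cast
    field_simp
  have hκ : ‖q‖ / q.re ≤ κ₀ := by
    rw [hqn, hqre, hκ₀, div_mul_cancel_left₀ hρ0.ne']
    gcongr
  have hκ1 : 1 ≤ ‖q‖ / q.re := by
    rw [one_le_div hq]
    exact (le_abs_self _).trans (Complex.abs_re_le_norm q)
  -- The exponent may be negative, but the base is at least `1`, so it can be raised to `B / γ₀`,
  -- which no longer depends on `b` and `γ`.
  have hpow : (‖q‖ / q.re) ^ (b / γ - 1) ≤ κ₀ ^ (B / γ₀) :=
    calc (‖q‖ / q.re) ^ (b / γ - 1) ≤ (‖q‖ / q.re) ^ (B / γ₀) := by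
          apply Real.rpow_le_rpow_of_exponent_le hκ1
          have : b / γ ≤ B / γ₀ := by gcongr
          linarith
      _ ≤ κ₀ ^ (B / γ₀) := by gcongr
  obtain ⟨R, hR, hbound⟩ := DegenerateDiffusion.exists_isResolventAt
    (DegenerateDiffusion.injective_sub hγ0 hb hq) (DegenerateDiffusion.surjective_sub hγ0 hb hq)
  rw [hq2] at hR hbound
  refine ⟨⟨R, hR⟩, fun f => ?_⟩
  rw [DegenerateDiffusion.resolvent_eq hR]
  refine (hbound f).trans ?_
  rw [div_mul_eq_mul_div, mul_div_assoc]
  gcongr
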